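/- Let $k$ be an algebraically closed field and $\mathbf{C}$ a finite length category over $k$: an essentially small $k$-linear abelian category in which all objects have finite length and all morphism spaces are finite dimensional. Let $L(\lambda)$, $\lambda\in\Lambda$, be representatives of the isomorphism classes of simple objects, and let $\le$ be a partial order on $\Lambda$. For $\Omega\subset\Lambda$ write $\mathbf{C}_\Omega$ for the Serre subcategory of $\mathbf{C}$ generated by the $L(\lambda)$ with $\lambda\in\Omega$, and $\mathbf{C}^\Omega=\mathbf{C}/\mathbf{C}_\Omega$ for the Serre quotient; an ideal in a poset is a subset that with each element contains every smaller element. Write $[M:S]$ for the Jordan-Hölder multiplicity of a simple object $S$ in $M$, and $\mathrm{Ext}$ for Yoneda extension groups. Assume that $(\mathbf{C},\le)$ is a lower finite highest weight category: each set $\{\mu\mid\mu\le\lambda\}$ is finite and, for each $\lambda\in\Lambda$, (i) $L(\lambda)$ has an injective hull $\nabla(\lambda)$ and a projective cover $\Delta(\lambda)$ in $\mathbf{C}_{\{\mu\mid\mu\le\lambda\}}$; (ii) $[\nabla(\lambda):L(\lambda)]=1$, and $\nabla(\lambda)$ is injective in $\mathbf{C}_\Omega$ for each finite ideal $\Omega$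 of $(\Lambda,\le)$ in which $\lambda$ is a maximal element; (iii) $\mathrm{Ext}^2_{\mathbf{C}}(\Delta(\lambda),\nabla(\mu))=0$ for all $\mu\in\Lambda$. Assume also that there is an equivalence $\Psi:\mathbf{C}^{\mathrm{op}}\to\mathbf{C}$ with $\Psi(L(\lambda))\simeq L(\lambda)$ for all $\lambda\in\Lambda$. Let $\le^e$ be the essential order, that is, the partial order on $\Lambda$ generated by the relations $\mu\le^e\lambda$ whenever $[\Delta(\lambda):L(\mu)]\ne0$ or $[\nabla(\lambda):L(\mu)]\neq 0$. Then: (a) A finite subset $\Omega\subset\Lambda$ is an ideal in $(\Lambda,\le^e)$ if and only if its elements can be ordered (without repetition) as $\mu_1,\dots,\mu_n$ such that, with $\Omega_i=\{\mu_1,\dots,\mu_{i-1}\}$, $$\mathrm{Ext}^2_{\mathbf{C}^{\Omega_i}}(L(\mu_i),L(\mu_i))=0\quad\text{for } 1\le i\le n,$$ where $L(\mu_i)$ also denotes its image in $\mathbf{C}^{\Omega_i}$. (b) For each $\lambda\in\Lambda$ the following are equivalent: (1) $\lambda$ is minimal for $\le^e$; (2) $\ell(\lambda)=0$, where $\ell(\lambda)$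 is the largest $n$ for which there are $\mu_1,\dots,\mu_n\in\Lambda$ with $\mu_n<^e\cdots<^e\mu_1<^e\lambda$; (3) the canonical morphisms $\Delta(\lambda)\to L(\lambda)$ and $L(\lambda)\to\nabla(\lambda)$ are isomorphisms; (4) $\mathrm{Ext}^2_{\mathbf{C}}(L(\lambda),L(\lambda))=0$; (5) $\mathrm{Ext}^\bullet_{\mathbf{C}}(L(\lambda),L(\lambda))=k$, that is, $k\to\mathrm{End}_{\mathbf{C}}(L(\lambda))$, $c\mapsto c\cdot\mathrm{id}$, is bijective and $\mathrm{Ext}^n_{\mathbf{C}}(L(\lambda),L(\lambda))=0$ for all $n>0$. -/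

import Mathlib

open CategoryTheory CategoryTheory.Limits ZeroObject

universe v u t s

namespace LFHW

section General

/-- A finite length category over `k`: an essentially small `k`-linear abelian category in which all
objects have finite length (are artinian and noetherian) and all morphism spaces are
finite dimensional. -/
structure IsFiniteLengthCategory (k : Type t) [Field k] (C : Type u) [Category.{v} C] [Abelian C]
    [Linear k C] : Prop where
  essentiallySmall : EssentiallySmall.{v} C
  finite_hom : ∀ X Y : C, Module.Finite k (X ⟶ Y)
  isArtinian : ∀ X : C, IsArtinianObject X
  isNoetherian : ∀ X : C, IsNoetherianObject X

/-- An injective hull: an essential monomorphism into an injective object. -/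
structure IsInjectiveHull {D : Type u} [Category.{v} D] {X I : D} (i : X ⟶ I) : Prop where
  injective : Injective I
  mono : Mono i
  essential : ∀ {Y : D} (g : I ⟶ Y), Mono (i ≫ g) → Mono g

/-- A projective cover: an essential epimorphism from a projective object. -/
structure IsProjectiveCover {D : Type u} [Category.{v} D] {P X : D} (p : P ⟶ X) : Prop where
  projective : Projective P
  epi : Epi p
  essential : ∀ {Y : D} (g : Y ⟶ P), Epi (g ≫ p) → Epi g

variable {C : Type u} [Category.{v} C] [Abelian C]

/-- `IsMultiplicity S M n`: the object `M` has a composition series in which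
exactly `n` of the simple subquotients are isomorphic to `S` (for `S` simple). -/
inductive IsMultiplicity (S : C) : C → ℕ → Prop
  | zero {M : C} (hM : IsZero M) : IsMultiplicity S M 0
  | add_one (E : ShortComplex C) (hE : E.ShortExact) (hS : Nonempty (E.X₃ ≅ S)) (n : ℕ)
      (h : IsMultiplicity S E.X₁ n) : IsMultiplicity S E.X₂ (n + 1)
  | add_zero (E : ShortComplex C) (hE : E.ShortExact) (hs : Simple E.X₃)
      (hS : IsEmpty (E.X₃ ≅ S)) (n : ℕ)
      (h : IsMultiplicity S E.X₁ n) : IsMultiplicity S E.X₂ n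

/-- The Jordan-Hölder multiplicity `[M : S]` of the simple object `S` in the finite length
object `M` (by the Jordan-Hölder theorem there is exactly one `n` with `IsMultiplicity S M n`). -/
noncomputable def multiplicity (M S : C) : ℕ := sInf {n | IsMultiplicity S M n}

/-- `Ext^n` in an abelian category (with values in a universe where it always exists). -/
abbrev ExtGroup (X Y : C) (n : ℕ) : Type (max u v) :=
  letI := HasExt.standard C
  Abelian.Ext.{max u v} X Y n

/-- `Ext^•(X, X) = k`: the structure map `k → Ext⁰(X, X) = End X` is bijective, and
`Ext^n(X, X) = 0` for all `n > 0`. -/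
def ExtAlgebraEqField (k : Type t) [Field k] [Linear k C] (X : C) : Prop :=
  letI := HasExt.standard C
  Function.Bijective (fun c : k => c • Abelian.Ext.mk₀.{max u v} (𝟙 X)) ∧
    ∀ n : ℕ, 0 < n → Subsingleton (ExtGroup X X n)

variable {Λ : Type s}

/-- `L` labels the isomorphism classes of simple objects by `Λ`. -/
structure IsSimpleLabelling (L : Λ → C) : Prop where
  simple : ∀ a, Simple (L a)
  eq_of_iso : ∀ a b, Nonempty (L a ≅ L b) → a = b
  exists_iso : ∀ S : C, Simple S → ∃ a, Nonempty (S ≅ L a)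

/-- The Serre subcategory of `C` generated by the objects `L a` with `a ∈ Ω`: the objects
that lie in every Serre subcategory containing these `L a`. -/
def serreSub (L : Λ → C) (Ω : Set Λ) : ObjectProperty C :=
  fun X => ∀ P : ObjectProperty C, P.IsSerreClass → (∀ a ∈ Ω, P (L a)) → P X

lemma serreSub_simple (L : Λ → C) {Ω : Set Λ} {a : Λ} (ha : a ∈ Ω) : serreSub L Ω (L a) :=
  fun _ _ h => h a ha

lemma serreSub_mono (L : Λ → C) {Ω Ω' : Set Λ} (h : Ω ⊆ Ω') {X : C} (hX : serreSub L Ω X) :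
    serreSub L Ω' X :=
  fun P hP hL => hX P hP fun a ha => hL a (h ha)

instance (L : Λ → C) (Ω : Set Λ) : (serreSub L Ω).IsSerreClass where
  exists_zero := ⟨0, isZero_zero C, fun P _ _ => P.prop_zero⟩
  prop_of_mono f _ h := fun P hP hL => P.prop_of_mono f (h P hP hL)
  prop_of_epi f _ h := fun P hP hL => P.prop_of_epi f (h P hP hL)
  prop_X₂_of_shortExact hS h₁ h₃ := fun P hP hL =>
    P.prop_X₂_of_shortExact hS (h₁ P hP hL) (h₃ P hP hL)

/-- The Serre quotient of `C` by the Serre subcategory generated by the `L a` with `a ∈ Ω`. -/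
abbrev SerreQuotient (L : Λ → C) (Ω : Set Λ) : Type u :=
  (serreSub L Ω).isoModSerre.Localization

noncomputable instance (L : Λ → C) (Ω : Set Λ) : Abelian (SerreQuotient L Ω) :=
  ObjectProperty.SerreClassLocalization.abelian (serreSub L Ω).isoModSerre.Q (serreSub L Ω)

/-- The quotient functor from `C` to the Serre quotient. -/
abbrev toSerreQuotient (L : Λ → C) (Ω : Set Λ) : C ⥤ SerreQuotient L Ω :=
  (serreSub L Ω).isoModSerre.Q

end General

/-- A lower finite highest weight structure on a finite length category `C` whose simple objects are
labelled by `L : Λ → C`, for the partial order of `Λ`. The (co)standard objects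
`delta a`, `nabla a` are a chosen projective cover and injective hull of `L a` in the Serre
subcategory generated by the `L b` with `b ≤ a` (hence unique up to isomorphism). -/
structure LowerFiniteHighestWeight {C : Type u} [Category.{v} C] [Abelian C] {Λ : Type s}
    [PartialOrder Λ] (L : Λ → C) where
  lowerFinite : ∀ a : Λ, (Set.Iic a).Finite
  nabla : Λ → C
  nabla_mem : ∀ a, serreSub L (Set.Iic a) (nabla a)
  ι : ∀ a, L a ⟶ nabla a
  isInjectiveHull : ∀ a,
    IsInjectiveHull (D := (serreSub L (Set.Iic a)).FullSubcategory)
      (X := ⟨L a, serreSub_simple L Set.self_mem_Iic⟩) (I := ⟨nabla a, nabla_mem a⟩)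
      (ObjectProperty.homMk (ι a))
  delta : Λ → C
  delta_mem : ∀ a, serreSub L (Set.Iic a) (delta a)
  π : ∀ a, delta a ⟶ L a
  isProjectiveCover : ∀ a,
    IsProjectiveCover (D := (serreSub L (Set.Iic a)).FullSubcategory)
      (P := ⟨delta a, delta_mem a⟩) (X := ⟨L a, serreSub_simple L Set.self_mem_Iic⟩)
      (ObjectProperty.homMk (π a))
  multiplicity_nabla : ∀ a, multiplicity (nabla a) (L a) = 1
  injective_nabla : ∀ (a : Λ) (Ω : Set Λ), Ω.Finite → ∀ (hΩ : IsLowerSet Ω)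
    (ha : Maximal (· ∈ Ω) a),
    Injective (⟨nabla a, serreSub_mono L (fun _ hb => hΩ hb ha.prop) (nabla_mem a)⟩ :
      (serreSub L Ω).FullSubcategory)
  ext_two : ∀ a b, Subsingleton (ExtGroup (delta a) (nabla b) 2)

namespace LowerFiniteHighestWeight

variable {C : Type u} [Category.{v} C] [Abelian C] {Λ : Type s} [PartialOrder Λ] {L : Λ → C}
  (H : LowerFiniteHighestWeight L)

/-- The essential order, generated by `b ≤ᵉ a` whenever `[Δ(a) : L(b)] ≠ 0` or `[∇(a) : L(b)] ≠ 0`: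
the reflexive transitive closure (it is antisymmetric since these relations imply `b ≤ a`). -/
def essLE : Λ → Λ → Prop :=
  Relation.ReflTransGen fun b a =>
    multiplicity (H.delta a) (L b) ≠ 0 ∨ multiplicity (H.nabla a) (L b) ≠ 0

/-- The strict essential order. -/
def essLT (b a : Λ) : Prop := H.essLE b a ∧ b ≠ a

/-- `Ω` is an ideal (a lower set) for the essential order. -/
def IsEssIdeal (Ω : Set Λ) : Prop := ∀ a ∈ Ω, ∀ b, H.essLE b a → b ∈ Ω

/-- `a` is minimal for the essential order. -/
def IsEssMin (a : Λ) : Prop := ∀ b, H.essLE b a → b = a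

/-- The maximal length `n` of a chain `s n <ᵉ ⋯ <ᵉ s 1 <ᵉ s 0 = a` (the lengths are bounded,
as there are finitely many `b ≤ a`). -/
noncomputable def essLength (a : Λ) : ℕ :=
  sSup {n | ∃ s : Fin (n + 1) → Λ, s 0 = a ∧ ∀ i : Fin n, H.essLT (s i.succ) (s i.castSucc)}

end LowerFiniteHighestWeight

end LFHW

/-! Both parts rest on one criterion: if Ω is an ideal for the essential order, a ∉ Ω and G : C →
C^Ω is the quotient functor, then Ext²(G L(a), G L(a)) = 0 exactly when Ω ∪ {a} is again such an
ideal (`subsingleton_ext_two_map_simple_iff`). Write K for the kernel of Δ(a) → L(a) and Q for the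
cokernel of L(a) → ∇(a). The duality gives K ≅ Ψ(Q), so Ω ∪ {a} is an ideal if and only if Q lies in
C_Ω (`isEssIdeal_insert_iff`).

If Q lies in C_Ω, so does K, hence G L(a) is both GΔ(a) and G∇(a). It then suffices that
Ext^n(GΔ(a), G∇(b)) = 0 for n > 0 (`subsingleton_ext_map_delta_map_nabla`). In degree one this
compares extensions in C and C^Ω: for b ∉ Ω the groups Ext^i(X, ∇(b)), i ≤ 2, vanish for X in C_Ω.
In higher degrees a class is killed by a monomorphism out of G∇(b), which lifts to some ∇(b) → E in
C. By `exists_filteredExtension`, ∇(b) embeds in an object I such that I/∇(b) is filtered by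
costandard objects and I is injective relative to a finite ideal supporting E. So ∇(b) → I factors
through E and kills the class; by induction on the degree, maps with such cokernels are injective on
Ext, and the class is zero.

Conversely, Ext²(G L(a), G L(a)) = 0 forces Ext¹(G L(a), GQ) = 0, so each map GK → GQ extends to
GΔ(a) → GQ, which is zero because L(a) is not a factor of Q. If Q were not in C_Ω, self-duality of
simples would provide a nonzero map from GK ≅ GΨ(Q) to GQ through a common simple object.

Part (a) iterates the criterion along an enumeration; part (b) is the case Ω = ∅, with G the
identity. -/

/-! ### Effaceability of extension classes by monomorphisms -/

section Effaceability

universe w v' u'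

variable {C : Type u'} [Category.{v'} C] [Abelian C]

-- Since K vanishes below degree i, its cohomology in degree i is a subobject of its term in that
-- degree.
open HomologicalComplex in
lemma CochainComplex.mono_from_single_f_of_quasiIsoAt {Y : C} {K : CochainComplex C ℤ}
    {i : ℤ} (ι : (single C (ComplexShape.up ℤ) i).obj Y ⟶ K) [K.IsStrictlyGE i]
    [QuasiIsoAt ι i] :
    Mono ((singleObjXSelf (ComplexShape.up ℤ) i Y).inv ≫ ι.f i) := by
  let e := K.pOpcyclesIso (i - 1) i (by simp)
    ((K.isZero_of_isStrictlyGE i (i - 1) (by simp)).eq_of_src _ _)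
  have : (singleObjXSelf (ComplexShape.up ℤ) i Y).inv ≫ ι.f i =
      (singleObjHomologySelfIso _ _ _).inv ≫ homologyMap ι i ≫ K.homologyι i ≫ e.inv := by
    rw [← cancel_mono e.hom]
    dsimp [e]
    rw [Category.assoc, Category.assoc, Category.assoc, Category.assoc, Iso.inv_hom_id,
      Category.comp_id, pOpcyclesIso_hom, homologyι_naturality]
    rw [singleObjHomologySelfIso_inv_homologyι_assoc, singleObjOpcyclesSelfIso_hom,
      Category.assoc, p_opcyclesMap]
  rw [this]
  infer_instance

open HomologicalComplex in
lemma CochainComplex.exists_single_map_eq_comp {Y : C} {K : CochainComplex C ℤ}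
    {i : ℤ} (ι : (single C (ComplexShape.up ℤ) i).obj Y ⟶ K) [K.IsStrictlyGE i]
    [QuasiIsoAt ι i] :
    ∃ (Z : C) (j : Y ⟶ Z) (p : K ⟶ (single C (ComplexShape.up ℤ) i).obj Z), Mono j ∧
      (single C (ComplexShape.up ℤ) i).map j = ι ≫ p := by
  refine ⟨K.X i, (singleObjXSelf (ComplexShape.up ℤ) i Y).inv ≫ ι.f i,
    mkHomToSingle (𝟙 _) (by
      rintro j rfl
      apply (K.isZero_of_isStrictlyGE (j + 1) j (by simp)).eq_of_src),
    mono_from_single_f_of_quasiIsoAt ι, ?_⟩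
  apply HomologicalComplex.to_single_hom_ext
  rw [comp_f, mkHomToSingle_f, Category.id_comp, single_map_f_self]
  simp

/-- Write φ as a fraction with denominator ι : Y[-i] → K and K zero below degree i. A monomorphism
from Y to the degree i term of K factors through ι, so φ composed with it becomes an honest chain
map between complexes in the distinct degrees 0 and i. No injective objects are needed. -/
lemma DerivedCategory.exists_mono_comp_singleFunctor_map_eq_zero [HasDerivedCategory.{w} C]
    {X Y : C} {i : ℤ} (hi : i ≠ 0)
    (φ : Q.obj ((CochainComplex.singleFunctor C 0).obj X) ⟶
      Q.obj ((CochainComplex.singleFunctor C i).obj Y)) :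
    ∃ (Z : C) (j : Y ⟶ Z), Mono j ∧ φ ≫ Q.map ((CochainComplex.singleFunctor C i).map j) = 0 := by
  obtain ⟨K, _, g, ι, h, rfl⟩ := left_fac_of_isStrictlyGE φ i
  have hι : QuasiIso ι := by rwa [isIso_Q_map_iff_quasiIso] at h
  have : QuasiIsoAt (C := C) (c := ComplexShape.up ℤ)
      (K := (HomologicalComplex.single C (ComplexShape.up ℤ) i).obj Y) ι i := hι.quasiIsoAt i
  obtain ⟨Z, j, p, hj, hp⟩ := CochainComplex.exists_single_map_eq_comp (Y := Y) (i := i) ι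
  refine ⟨Z, j, hj, ?_⟩
  let p' : K ⟶ (CochainComplex.singleFunctor C i).obj Z := p
  have h₁ : (CochainComplex.singleFunctor C i).map j = ι ≫ p' := hp
  have h₂ : g ≫ p' = 0 := by
    apply HomologicalComplex.to_single_hom_ext
    apply IsZero.eq_of_src
    exact HomologicalComplex.isZero_single_obj_X _ _ _ _ hi
  rw [h₁, Q.map_comp, Category.assoc, IsIso.inv_hom_id_assoc, ← Q.map_comp, h₂, Q.map_zero]

namespace CategoryTheory.Abelian.Ext

variable [HasExt.{w} C]

/-- Positive degree extension classes are effaceable in the second variable. -/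
lemma exists_mono_comp_mk₀_eq_zero {X Y : C} {n : ℕ} (x : Ext.{w} X Y (n + 1)) :
    ∃ (Z : C) (j : Y ⟶ Z), Mono j ∧ x.comp (mk₀ j) (add_zero _) = 0 := by
  let := HasDerivedCategory.standard C
  -- The shift of Y by n + 1 is Y placed in degree -(n + 1), which is nonzero as the previous lemma
  -- requires.
  let e := ((DerivedCategory.singleFunctors C).shiftIso ((n + 1 : ℕ) : ℤ) (-(n + 1 : ℕ)) 0
    (by lia)).hom
  obtain ⟨Z, j, hj, h⟩ := DerivedCategory.exists_mono_comp_singleFunctor_map_eq_zero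
    (i := -(n + 1 : ℕ)) (by lia) (x.hom ≫ e.app Y)
  refine ⟨Z, j, hj, ?_⟩
  ext
  rw [comp_hom, zero_hom, mk₀_hom, ShiftedHom.comp_mk₀]
  have hZ := e.naturality j
  rw [← cancel_mono (e.app Z), Limits.zero_comp, Category.assoc]
  exact (congrArg (x.hom ≫ ·) hZ).trans ((Category.assoc _ _ _).symm.trans h)

end CategoryTheory.Abelian.Ext

end Effaceability

/-! ### Vanishing from long exact sequences, and extensions of degree one -/

section ExtVanishing

universe w v' u'

variable {C : Type u'} [Category.{v'} C] [Abelian C]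

namespace CategoryTheory.ShortComplex

lemma shortExact_cokernel {X Y : C} (i : X ⟶ Y) [Mono i] :
    (ShortComplex.mk i (cokernel.π i) (cokernel.condition i)).ShortExact where
  exact := ShortComplex.exact_cokernel i

lemma shortExact_kernel {X Y : C} (p : X ⟶ Y) [Epi p] :
    (ShortComplex.mk (kernel.ι p) p (kernel.condition p)).ShortExact where
  exact := ShortComplex.exact_kernel p

/-- The pullback of a short exact sequence along a morphism to its third term. -/
lemma ShortExact.pullback {S : ShortComplex C} (hS : S.ShortExact) {T : C} (h : T ⟶ S.X₃) :
    (ShortComplex.mk (pullback.lift (f := S.g) (g := h) S.f (0 : S.X₁ ⟶ T) (by simp))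
      (pullback.snd S.g h) (pullback.lift_snd _ _ _)).ShortExact := by
  have := hS.mono_f
  have := hS.epi_g
  have hm : Mono (pullback.lift (f := S.g) (g := h) S.f (0 : S.X₁ ⟶ T) (by simp)) :=
    mono_of_mono_fac (pullback.lift_fst _ _ _)
  refine ShortExact.mk' (exact_of_f_is_kernel _ ?_) hm inferInstance
  refine KernelFork.IsLimit.ofι' _ _ fun {A} k hk => ⟨hS.exact.lift (k ≫ pullback.fst _ _) ?_, ?_⟩
  · dsimp at hk
    rw [Category.assoc, pullback.condition, reassoc_of% hk, zero_comp]
  · dsimp at hk ⊢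
    apply pullback.hom_ext
    · rw [Category.assoc, pullback.lift_fst, hS.exact.lift_f]
    · rw [Category.assoc, pullback.lift_snd, comp_zero, hk]

end CategoryTheory.ShortComplex

namespace CategoryTheory.Abelian.Ext

variable [HasExt.{w} C] {S : ShortComplex C} (hS : S.ShortExact) {X Y : C} {n : ℕ}

include hS in
lemma subsingleton_middle_right (h₁ : Subsingleton (Ext.{w} X S.X₁ n))
    (h₃ : Subsingleton (Ext.{w} X S.X₃ n)) : Subsingleton (Ext.{w} X S.X₂ n) :=
  subsingleton_of_forall_eq 0 fun x => by
    obtain ⟨y, rfl⟩ := covariant_sequence_exact₂ X hS x (Subsingleton.elim _ _)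
    rw [Subsingleton.elim y 0, zero_comp]

include hS in
lemma subsingleton_middle_left (h₁ : Subsingleton (Ext.{w} S.X₁ Y n))
    (h₃ : Subsingleton (Ext.{w} S.X₃ Y n)) : Subsingleton (Ext.{w} S.X₂ Y n) :=
  subsingleton_of_forall_eq 0 fun x => by
    obtain ⟨y, rfl⟩ := contravariant_sequence_exact₂ hS Y x (Subsingleton.elim _ _)
    rw [Subsingleton.elim y 0, comp_zero]

include hS in
lemma subsingleton_sub_left (h₂ : Subsingleton (Ext.{w} S.X₂ Y n))
    (h₃ : Subsingleton (Ext.{w} S.X₃ Y (n + 1))) : Subsingleton (Ext.{w} S.X₁ Y n) :=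
  subsingleton_of_forall_eq 0 fun x => by
    obtain ⟨y, rfl⟩ := contravariant_sequence_exact₁ hS Y x (add_comm 1 n)
      (Subsingleton.elim _ _)
    rw [Subsingleton.elim y 0, comp_zero]

include hS in
lemma subsingleton_quotient_left (h₁ : Subsingleton (Ext.{w} S.X₁ Y n))
    (h₂ : Subsingleton (Ext.{w} S.X₂ Y (n + 1))) : Subsingleton (Ext.{w} S.X₃ Y (n + 1)) :=
  subsingleton_of_forall_eq 0 fun x => by
    obtain ⟨y, rfl⟩ := contravariant_sequence_exact₃ hS Y x (Subsingleton.elim _ _)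
      (add_comm 1 n)
    rw [Subsingleton.elim y 0, comp_zero]

include hS in
lemma subsingleton_quotient_right (h₂ : Subsingleton (Ext.{w} X S.X₂ n))
    (h₁ : Subsingleton (Ext.{w} X S.X₁ (n + 1))) : Subsingleton (Ext.{w} X S.X₃ n) :=
  subsingleton_of_forall_eq 0 fun x => by
    obtain ⟨y, rfl⟩ := covariant_sequence_exact₃ X hS x rfl (Subsingleton.elim _ _)
    rw [Subsingleton.elim y 0, zero_comp]

lemma subsingleton_zero_iff : Subsingleton (Ext.{w} X Y 0) ↔ ∀ f : X ⟶ Y, f = 0 :=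
  ⟨fun _ f => (mk₀_eq_zero_iff f).1 (Subsingleton.elim _ _), fun h =>
    subsingleton_of_forall_eq 0 fun x => by
      obtain ⟨f, rfl⟩ := addEquiv₀.symm.surjective x
      simp [h f]⟩

lemma subsingleton_of_iso {X' Y' : C} (eX : X ≅ X') (eY : Y ≅ Y')
    (h : Subsingleton (Ext.{w} X Y n)) : Subsingleton (Ext.{w} X' Y' n) :=
  subsingleton_of_forall_eq 0 fun x => by
    have hx : ((mk₀ eX.hom).comp x (zero_add n)).comp (mk₀ eY.inv) (add_zero n) = 0 :=
      Subsingleton.elim _ _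
    have := congrArg
      (fun y => ((mk₀ eX.inv).comp y (zero_add n)).comp (mk₀ eY.hom) (add_zero n)) hx
    simpa only [comp_assoc_of_third_deg_zero, mk₀_comp_mk₀, mk₀_comp_mk₀_assoc, Iso.inv_hom_id,
      mk₀_id_comp, comp_mk₀_id, zero_comp, comp_zero] using this

lemma subsingleton_of_isZero_left (h : IsZero X) : Subsingleton (Ext.{w} X Y n) :=
  subsingleton_of_forall_eq 0 fun x => by
    rw [← mk₀_id_comp x, h.eq_of_src (𝟙 X) 0, mk₀_zero, zero_comp]

lemma subsingleton_of_isZero_right (h : IsZero Y) : Subsingleton (Ext.{w} X Y n) :=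
  subsingleton_of_forall_eq 0 fun x => by
    rw [← comp_mk₀_id x, h.eq_of_src (𝟙 Y) 0, mk₀_zero, comp_zero]

lemma exists_extension_of_mono {Z I : C} (i : Y ⟶ Z) [Mono i]
    (h : Subsingleton (Ext.{w} (cokernel i) I 1)) (f : Y ⟶ I) : ∃ g : Z ⟶ I, i ≫ g = f := by
  obtain ⟨y, hy⟩ := contravariant_sequence_exact₁ (ShortComplex.shortExact_cokernel i) I
    (mk₀.{w} f) (add_zero 1) (Subsingleton.elim (α := Ext.{w} (cokernel i) I 1) _ _)
  obtain ⟨g, rfl⟩ := addEquiv₀.symm.surjective y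
  refine ⟨g, (mk₀_bijective _ _).1 ?_⟩
  simpa using hy

/-- Every class of degree one is the class of a short exact sequence. -/
lemma exists_shortExact_extClass_eq (x : Ext.{w} X Y 1) :
    ∃ (E : C) (f : Y ⟶ E) (g : E ⟶ X) (h : f ≫ g = 0)
      (hS : (ShortComplex.mk f g h).ShortExact), hS.extClass = x := by
  obtain ⟨Z, j, _, hj⟩ := exists_mono_comp_mk₀_eq_zero x
  have hZ := ShortComplex.shortExact_cokernel j
  obtain ⟨y, hy⟩ := covariant_sequence_exact₁ X hZ x hj rfl
  obtain ⟨q, rfl⟩ := addEquiv₀.symm.surjective y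
  refine ⟨_, _, _, _, hZ.pullback q, ?_⟩
  have := ShortComplex.ShortExact.extClass_naturality (hZ.pullback q) hZ
    { τ₁ := 𝟙 _, τ₂ := pullback.fst _ _, τ₃ := q
      comm₁₂ := (Category.id_comp _).trans (pullback.lift_fst _ _ _).symm
      comm₂₃ := pullback.condition }
  rw [comp_mk₀_id] at this
  rw [this]
  exact hy

/-- `Ext¹(X, Y)` vanishes if every extension of `X` by `Y` splits. -/
lemma subsingleton_one_of_split
    (h : ∀ (E : C) (f : Y ⟶ E) (g : E ⟶ X) (w : f ≫ g = 0),
      (ShortComplex.mk f g w).ShortExact → ∃ r : E ⟶ Y, f ≫ r = 𝟙 Y) :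
    Subsingleton (Ext.{w} X Y 1) :=
  subsingleton_of_forall_eq 0 fun x => by
    obtain ⟨E, f, g, w, hS, rfl⟩ := exists_shortExact_extClass_eq x
    obtain ⟨r, hr⟩ := h E f g w hS
    rw [← comp_mk₀_id hS.extClass]
    dsimp only
    rw [← hr, ← mk₀_comp_mk₀, hS.extClass_comp_assoc]

/-- `Ext¹(X, Y)` vanishes if every extension of `X` by `Y` splits. -/
lemma subsingleton_one_of_split'
    (h : ∀ (E : C) (f : Y ⟶ E) (g : E ⟶ X) (w : f ≫ g = 0),
      (ShortComplex.mk f g w).ShortExact → ∃ r : X ⟶ E, r ≫ g = 𝟙 X) :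
    Subsingleton (Ext.{w} X Y 1) :=
  subsingleton_of_forall_eq 0 fun x => by
    obtain ⟨E, f, g, w, hS, rfl⟩ := exists_shortExact_extClass_eq x
    obtain ⟨r, hr⟩ := h E f g w hS
    rw [← mk₀_id_comp hS.extClass]
    dsimp only
    rw [← hr, ← mk₀_comp_mk₀, comp_assoc_of_second_deg_zero, hS.comp_extClass, comp_zero]

end CategoryTheory.Abelian.Ext

end ExtVanishing

/-! ### Finite length induction and Serre classes -/

namespace CategoryTheory

section FiniteLength

variable {C : Type u} [Category.{v} C] [Abelian C]

/-- Take a maximal subobject with the property: the preimage of T contains it, so if it had the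
property it would be equal to it and T would vanish. This serves both for finite length induction
and for the largest subobject in a Serre class. -/
lemma ObjectProperty.exists_maximal_mono (R : ObjectProperty C) [R.IsClosedUnderIsomorphisms]
    (h₀ : ∀ X, IsZero X → R X) (X : C) [IsNoetherianObject X] :
    ∃ (A : C) (i : A ⟶ X), Mono i ∧ R A ∧
      ∀ (T : C) (t : T ⟶ cokernel i), Mono t → ¬ IsZero T → ¬ R (pullback (cokernel.π i) t) := by
  obtain ⟨A, hA, hmax⟩ := (wellFounded_gt (α := Subobject X)).has_min
    {A | R (A : C)} ⟨⊥, h₀ _ ((isZero_zero C).of_iso Subobject.botCoeIsoZero)⟩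
  refine ⟨A, A.arrow, inferInstance, hA, fun T t _ hT hR => ?_⟩
  have hle : A ≤ Subobject.mk (pullback.fst (cokernel.π A.arrow) t) :=
    Subobject.le_mk_of_comm (pullback.lift A.arrow 0 (by simp)) (pullback.lift_fst _ _ _)
  have hB : Subobject.mk (pullback.fst (cokernel.π A.arrow) t) ∈ {A : Subobject X | R (A : C)} :=
    R.prop_of_iso (Subobject.underlyingIso _).symm hR
  have heq := hle.eq_of_not_lt (hmax _ hB)
  have hfac : pullback.fst (cokernel.π A.arrow) t ≫ cokernel.π A.arrow = 0 := by
    rw [← Subobject.ofMkLE_arrow heq.ge, Category.assoc, cokernel.condition, comp_zero]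
  rw [pullback.condition] at hfac
  have hsnd := (cancel_mono t).1 (hfac.trans zero_comp.symm)
  apply hT
  rw [IsZero.iff_id_eq_zero, ← cancel_epi (pullback.snd (cokernel.π A.arrow) t), hsnd]
  simp

variable [∀ X : C, IsArtinianObject X] [∀ X : C, IsNoetherianObject X]

/-- Induction on objects of finite length. -/
lemma finiteLength_induction (R : ObjectProperty C) [R.IsClosedUnderIsomorphisms]
    (h₀ : ∀ X, IsZero X → R X)
    (h₁ : ∀ S : ShortComplex C, S.ShortExact → Simple S.X₃ → R S.X₁ → R S.X₂) (X : C) : R X := by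
  obtain ⟨A, i, _, hA, hmax⟩ := R.exists_maximal_mono h₀ X
  by_cases hi : IsZero (cokernel i)
  · have : Epi i := Preadditive.epi_of_isZero_cokernel i hi
    have := isIso_of_mono_of_epi i
    exact R.prop_of_iso (asIso i) hA
  · obtain ⟨Y, hY⟩ := exists_simple_subobject hi
    exact (hmax _ Y.arrow inferInstance (Simple.not_isZero _)
      (h₁ _ ((ShortComplex.shortExact_cokernel i).pullback Y.arrow) hY hA)).elim

end FiniteLength

section Avoiding

variable {C : Type u} [Category.{v} C] [Abelian C]

/-- The objects none of whose subobjects has a nonzero morphism to `S`. -/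
def ObjectProperty.avoiding (S : C) : ObjectProperty C :=
  fun X => ∀ ⦃A : C⦄ (i : A ⟶ X), Mono i → ∀ f : A ⟶ S, f = 0

instance (S : C) : (ObjectProperty.avoiding S).IsSerreClass where
  exists_zero := ⟨0, isZero_zero C, fun A i _ f =>
    ((isZero_zero C).of_mono i).eq_of_src _ _⟩
  prop_of_mono g _ h := fun A i _ f => h (i ≫ g) inferInstance f
  prop_of_epi g _ h := fun A i _ f => by
    rw [← cancel_epi (pullback.snd g i), h (pullback.fst g i) inferInstance (pullback.snd g i ≫ f),
      comp_zero]
  prop_X₂_of_shortExact {S'} hS h₁ h₃ := fun A i _ f => by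
    have := hS.mono_f
    -- The part of A that dies in X₃ is a subobject of X₁, so f descends to the coimage of A → X₃,
    -- which is a subobject of X₃.
    have hk : kernel.ι (i ≫ S'.g) ≫ f = 0 := by
      let j := hS.exact.lift (kernel.ι (i ≫ S'.g) ≫ i) (by simp)
      have : Mono j := mono_of_mono_fac (hS.exact.lift_f _ _)
      exact h₁ j this _
    have hmono : Mono (Abelian.factorThruCoimage (i ≫ S'.g)) := inferInstance
    have hz := h₃ _ hmono (cokernel.desc _ f hk)
    rw [← cokernel.π_desc (kernel.ι (i ≫ S'.g)) f hk]
    exact (congrArg (_ ≫ ·) hz).trans comp_zero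

end Avoiding

end CategoryTheory

/-! ### Composition factors and Serre subcategories -/

namespace LFHW

variable {C : Type u} [Category.{v} C] [Abelian C] {Λ : Type s} {L : Λ → C}

/-- If a ∉ Ω, the objects avoiding L(a) form a Serre class that contains every L(b) with b ∈ Ω but
not L(a). -/
lemma IsSimpleLabelling.serreSub_obj_iff (hL : IsSimpleLabelling L) {Ω : Set Λ} {a : Λ} :
    serreSub L Ω (L a) ↔ a ∈ Ω := by
  refine ⟨fun h => ?_, serreSub_simple L⟩
  by_contra ha
  have h' := h (ObjectProperty.avoiding (L a)) inferInstance fun b hb A i _ f => by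
    have := hL.simple a
    have := hL.simple b
    by_cases hi : i = 0
    · have hA : IsZero A := by
        rw [IsZero.iff_id_eq_zero, ← cancel_mono i, hi]; simp
      exact hA.eq_of_src _ _
    · have := isIso_of_mono_of_nonzero hi
      by_contra hf
      have hf' : inv i ≫ f ≠ 0 := fun h0 => hf (by simpa using h0)
      have := isIso_of_hom_simple hf'
      exact ha (hL.eq_of_iso b a ⟨asIso (inv i ≫ f)⟩ ▸ hb)
  have := hL.simple a
  exact id_nonzero (L a) (h' (𝟙 _) inferInstance (𝟙 _))

variable [∀ X : C, IsArtinianObject X] [∀ X : C, IsNoetherianObject X]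

lemma IsSimpleLabelling.serreSub_induction (hL : IsSimpleLabelling L) {Ω : Set Λ}
    (R : ObjectProperty C) [R.IsClosedUnderIsomorphisms] (h₀ : ∀ X, IsZero X → R X)
    (h₁ : ∀ S : ShortComplex C, S.ShortExact → R S.X₁ → R S.X₃ → R S.X₂)
    (h : ∀ a ∈ Ω, R (L a)) {X : C} (hX : serreSub L Ω X) : R X := by
  let R' : ObjectProperty C := fun X => serreSub L Ω X → R X
  have : R'.IsClosedUnderIsomorphisms :=
    ⟨fun e h hX => R.prop_of_iso e (h ((serreSub L Ω).prop_of_iso e.symm hX))⟩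
  refine finiteLength_induction R' (fun X hX _ => h₀ X hX) (fun S hS hs h' hX => ?_) X hX
  have hX' := ((serreSub L Ω).prop_iff_of_shortExact hS).1 hX
  obtain ⟨a, ⟨e⟩⟩ := hL.exists_iso _ hs
  have ha : a ∈ Ω := hL.serreSub_obj_iff.1 ((serreSub L Ω).prop_of_iso e hX'.2)
  exact h₁ S hS (h' hX'.1) (R.prop_of_iso e.symm (h a ha))

/-- Membership in a Serre subcategory can be tested one excluded simple factor at a time, which
matches it with the vanishing of multiplicities. -/
lemma IsSimpleLabelling.serreSub_of_forall_notMem (hL : IsSimpleLabelling L) {Γ : Set Λ} {X : C}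
    (h : ∀ b ∉ Γ, serreSub L {b}ᶜ X) : serreSub L Γ X := by
  let R : ObjectProperty C := fun X => (∀ b ∉ Γ, serreSub L {b}ᶜ X) → serreSub L Γ X
  have : R.IsClosedUnderIsomorphisms :=
    ⟨fun e h hX => ObjectProperty.prop_of_iso _ e (h fun b hb =>
      ObjectProperty.prop_of_iso _ e.symm (hX b hb))⟩
  refine finiteLength_induction R (fun X hX _ => (serreSub L Γ).prop_of_isZero hX)
    (fun S hS hs h' hX => ?_) X h
  have hX' := fun b hb => (ObjectProperty.prop_iff_of_shortExact _ hS).1 (hX b hb)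
  refine (serreSub L Γ).prop_X₂_of_shortExact hS (h' fun b hb => (hX' b hb).1) ?_
  obtain ⟨a, ⟨e⟩⟩ := hL.exists_iso _ hs
  refine (serreSub L Γ).prop_of_iso e.symm (serreSub_simple L ?_)
  by_contra ha
  exact hL.serreSub_obj_iff.1 ((serreSub L {a}ᶜ).prop_of_iso e (hX' a ha).2) rfl

lemma exists_isMultiplicity (S M : C) : ∃ n, IsMultiplicity S M n := by
  let R : ObjectProperty C := fun M => ∃ n, IsMultiplicity S M n
  have : R.IsClosedUnderIsomorphisms := ⟨fun {X Y} e h => by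
    obtain ⟨n, hn⟩ := h
    refine ⟨n, ?_⟩
    cases hn with
    | zero hM => exact .zero (hM.of_iso e.symm)
    | add_one E hE hS n h =>
      let E' := ShortComplex.mk (E.f ≫ e.hom) (e.inv ≫ E.g) (by simp)
      let i : E ≅ E' := ShortComplex.isoMk (Iso.refl _) e (Iso.refl _) (by simp [E']) (by simp [E'])
      exact .add_one E' (ShortComplex.shortExact_of_iso i hE) hS n h
    | add_zero E hE hs hS n h =>
      let E' := ShortComplex.mk (E.f ≫ e.hom) (e.inv ≫ E.g) (by simp)
      let i : E ≅ E' := ShortComplex.isoMk (Iso.refl _) e (Iso.refl _) (by simp [E']) (by simp [E'])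
      exact .add_zero E' (ShortComplex.shortExact_of_iso i hE) hs hS _ h⟩
  refine finiteLength_induction R (fun X hX => ⟨0, .zero hX⟩) (fun E hE hs h => ?_) M
  obtain ⟨n, hn⟩ := h
  by_cases hS : Nonempty (E.X₃ ≅ S)
  · exact ⟨_, .add_one E hE hS n hn⟩
  · exact ⟨_, .add_zero E hE hs (not_nonempty_iff.1 hS) n hn⟩

omit [∀ X : C, IsArtinianObject X] [∀ X : C, IsNoetherianObject X] in
lemma IsMultiplicity.serreSub_of_eq_zero (hL : IsSimpleLabelling L) {b : Λ} {M : C} {n : ℕ}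
    (h : IsMultiplicity (L b) M n) (hn : n = 0) : serreSub L {b}ᶜ M := by
  induction h with
  | zero hM => exact (serreSub L _).prop_of_isZero hM
  | add_one => omega
  | add_zero E hE hs hS n h ih =>
    refine (serreSub L _).prop_X₂_of_shortExact hE (ih hn) ?_
    obtain ⟨a, ⟨e⟩⟩ := hL.exists_iso _ hs
    refine (serreSub L _).prop_of_iso e.symm (serreSub_simple L ?_)
    rintro rfl
    exact hS.elim e

lemma IsSimpleLabelling.isMultiplicity_zero (hL : IsSimpleLabelling L) {b : Λ} {M : C}
    (h : serreSub L {b}ᶜ M) : IsMultiplicity (L b) M 0 := by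
  obtain ⟨n, hn⟩ := exists_isMultiplicity (L b) M
  suffices n = 0 by rwa [← this]
  induction hn with
  | zero hM => rfl
  | add_one E hE hS n _ ih =>
    obtain ⟨e⟩ := hS
    have := (ObjectProperty.prop_iff_of_shortExact _ hE).1 h
    exact (hL.serreSub_obj_iff.1 ((serreSub L {b}ᶜ).prop_of_iso e this.2) rfl).elim
  | add_zero E hE hs hS n _ ih =>
    exact ih ((ObjectProperty.prop_iff_of_shortExact _ hE).1 h).1

/-- The infimum could be zero for an empty set; existence of a composition series excludes this, and
uniqueness of multiplicities is not needed. -/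
lemma IsSimpleLabelling.multiplicity_eq_zero_iff (hL : IsSimpleLabelling L) {b : Λ} {M : C} :
    multiplicity M (L b) = 0 ↔ serreSub L {b}ᶜ M := by
  rw [multiplicity, Nat.sInf_eq_zero]
  refine ⟨fun h => ?_, fun h => Or.inl (hL.isMultiplicity_zero h)⟩
  rcases h with h | h
  · exact IsMultiplicity.serreSub_of_eq_zero hL h rfl
  · obtain ⟨n, hn⟩ := exists_isMultiplicity (L b) M
    exact (Set.eq_empty_iff_forall_notMem.1 h n hn).elim

omit [∀ X : C, IsArtinianObject X] [∀ X : C, IsNoetherianObject X] in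
lemma IsMultiplicity.serreSub_cokernel (hL : IsSimpleLabelling L) {b : Λ} {M : C} {n : ℕ}
    (h : IsMultiplicity (L b) M n) (hn : n = 1) (i : L b ⟶ M) [Mono i] :
    serreSub L {b}ᶜ (cokernel i) := by
  -- The cokernel of i is an extension of a quotient Z of X₃ that is killed by i by a quotient of Y.
  have key : ∀ (E : ShortComplex C), E.ShortExact → ∀ (i : L b ⟶ E.X₂) (Y : C)
      (u : Y ⟶ cokernel i) (r : E.X₁ ⟶ Y), r ≫ u = E.f ≫ cokernel.π i → serreSub L {b}ᶜ Y →
      (∀ (Z : C) (w : E.X₃ ⟶ Z), Epi w → i ≫ E.g ≫ w = 0 → serreSub L {b}ᶜ Z) →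
      serreSub L {b}ᶜ (cokernel i) := by
    intro E hE i Y u r hu hY hZ
    have := hE.epi_g
    have hf : E.f ≫ cokernel.π i ≫ cokernel.π u = 0 := by
      rw [← Category.assoc, ← hu, Category.assoc, cokernel.condition, comp_zero]
    have hw := hE.exact.g_desc (cokernel.π i ≫ cokernel.π u) hf
    have := epi_of_epi_fac hw
    refine (serreSub L _).prop_X₂_of_exact (ShortComplex.exact_cokernel u) hY
      (hZ _ _ this ?_)
    rw [hw, cokernel.condition_assoc, zero_comp]
  induction h with
  | zero hM => omega
  | add_one E hE hS n h ih =>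
    obtain rfl : n = 0 := by omega
    have h₁ := h.serreSub_of_eq_zero hL rfl
    refine key E hE i _ (E.f ≫ cokernel.π i) (𝟙 _) (by simp) h₁ fun Z w _ hw => ?_
    have := hE.mono_f
    have := hL.simple b
    have : Simple E.X₃ := Simple.of_iso hS.some
    -- Otherwise L(b) would embed in X₁, which no longer has it as a factor. So i maps
    -- isomorphically onto X₃, and Z = 0.
    have hi : i ≫ E.g ≠ 0 := fun h0 => by
      have : Mono (hE.exact.lift i h0) := mono_of_mono_fac (hE.exact.lift_f i h0)
      exact hL.serreSub_obj_iff.1 ((serreSub L {b}ᶜ).prop_of_mono (hE.exact.lift i h0) h₁) rfl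
    have := isIso_of_hom_simple hi
    have hw0 : w = 0 := by
      rw [← cancel_epi (i ≫ E.g), Category.assoc, hw, comp_zero]
    apply (serreSub L _).prop_of_isZero
    rw [IsZero.iff_id_eq_zero, ← cancel_epi w, hw0]
    simp
  | add_zero E hE hs hS n h ih =>
    have := hL.simple b
    have := hE.mono_f
    -- The top factor is not L(b), so i factors through X₁ and induction applies there.
    have hi : i ≫ E.g = 0 := by
      by_contra hi
      have := isIso_of_hom_simple hi
      exact hS.elim (asIso (i ≫ E.g)).symm
    let j := hE.exact.lift i hi
    have hj : j ≫ E.f = i := hE.exact.lift_f i hi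
    have : Mono j := mono_of_mono_fac hj
    refine key E hE i _ (cokernel.desc j (E.f ≫ cokernel.π i) ?_) (cokernel.π j) (cokernel.π_desc _ _ _)
      (ih hn j) fun Z w _ hw => ?_
    · rw [← Category.assoc, hj, cokernel.condition]
    · obtain ⟨a, ⟨e⟩⟩ := hL.exists_iso _ hs
      refine (serreSub L _).prop_of_epi w
        ((serreSub L _).prop_of_iso e.symm (serreSub_simple L ?_))
      rintro rfl
      exact hS.elim e

lemma IsSimpleLabelling.serreSub_cokernel_of_multiplicity_eq_one (hL : IsSimpleLabelling L)
    {b : Λ} {M : C} (h : multiplicity M (L b) = 1) (i : L b ⟶ M) [Mono i] :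
    serreSub L {b}ᶜ (cokernel i) :=
  IsMultiplicity.serreSub_cokernel hL
    (h ▸ Nat.sInf_mem (exists_isMultiplicity (L b) M) : IsMultiplicity (L b) M 1) rfl i

end LFHW

/-! ### Relative injectives and projectives; standard and costandard objects -/

namespace CategoryTheory.ObjectProperty

variable {C : Type u} [Category.{v} C] [Abelian C] (P : ObjectProperty C) [P.IsSerreClass]

lemma mono_hom_of_mono {X Y : P.FullSubcategory} (f : X ⟶ Y) [Mono f] : Mono f.hom := by
  apply Preadditive.mono_of_kernel_zero
  let K : P.FullSubcategory := ⟨kernel f.hom, P.prop_of_mono (kernel.ι f.hom) X.property⟩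
  let k : K ⟶ X := homMk (kernel.ι f.hom)
  have : k ≫ f = 0 ≫ f := by
    ext; exact (kernel.condition f.hom).trans zero_comp.symm
  exact congrArg InducedCategory.Hom.hom ((cancel_mono f).1 this)

lemma epi_hom_of_epi {X Y : P.FullSubcategory} (f : X ⟶ Y) [Epi f] : Epi f.hom := by
  apply Preadditive.epi_of_cokernel_zero
  let K : P.FullSubcategory := ⟨cokernel f.hom, P.prop_of_epi (cokernel.π f.hom) Y.property⟩
  let k : Y ⟶ K := homMk (cokernel.π f.hom)
  have : f ≫ k = f ≫ 0 := by
    ext; exact (cokernel.condition f.hom).trans comp_zero.symm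
  exact congrArg InducedCategory.Hom.hom ((cancel_epi f).1 this)

lemma exists_extension_of_injective {I : C} (hI : P I)
    (h : Injective (⟨I, hI⟩ : P.FullSubcategory)) {X Y : C} (hY : P Y) (i : X ⟶ Y) [Mono i]
    (f : X ⟶ I) : ∃ g : Y ⟶ I, i ≫ g = f := by
  let i' : (⟨X, P.prop_of_mono i hY⟩ : P.FullSubcategory) ⟶ ⟨Y, hY⟩ := homMk i
  have : Mono i' := P.ι.mono_of_mono_map (inferInstanceAs (Mono i))
  let f' : (⟨X, P.prop_of_mono i hY⟩ : P.FullSubcategory) ⟶ ⟨I, hI⟩ := homMk f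
  exact ⟨(Injective.factorThru f' i').hom,
    congrArg InducedCategory.Hom.hom (Injective.comp_factorThru f' i')⟩

lemma exists_lift_of_projective {Q : C} (hQ : P Q)
    (h : Projective (⟨Q, hQ⟩ : P.FullSubcategory)) {X Y : C} (hX : P X) (p : X ⟶ Y) [Epi p]
    (f : Q ⟶ Y) : ∃ g : Q ⟶ X, g ≫ p = f := by
  let p' : (⟨X, hX⟩ : P.FullSubcategory) ⟶ ⟨Y, P.prop_of_epi p hX⟩ := homMk p
  have : Epi p' := P.ι.epi_of_epi_map (inferInstanceAs (Epi p))
  let f' : (⟨Q, hQ⟩ : P.FullSubcategory) ⟶ ⟨Y, P.prop_of_epi p hX⟩ := homMk f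
  exact ⟨(Projective.factorThru f' p').hom,
    congrArg InducedCategory.Hom.hom (Projective.factorThru_comp f' p')⟩

end CategoryTheory.ObjectProperty

namespace LFHW.LowerFiniteHighestWeight

open Abelian

variable {C : Type u} [Category.{v} C] [Abelian C] {Λ : Type s} [PartialOrder Λ] {L : Λ → C}
  (H : LowerFiniteHighestWeight L)

lemma mono_ι (a : Λ) : Mono (H.ι a) :=
  have := (H.isInjectiveHull a).mono
  (serreSub L (Set.Iic a)).mono_hom_of_mono (X := ⟨L a, serreSub_simple L Set.self_mem_Iic⟩)
    (Y := ⟨H.nabla a, H.nabla_mem a⟩) (ObjectProperty.homMk (H.ι a))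

lemma epi_π (a : Λ) : Epi (H.π a) :=
  have := (H.isProjectiveCover a).epi
  (serreSub L (Set.Iic a)).epi_hom_of_epi (Y := ⟨L a, serreSub_simple L Set.self_mem_Iic⟩)
    (X := ⟨H.delta a, H.delta_mem a⟩) (ObjectProperty.homMk (H.π a))

lemma mono_of_mono_ι_comp {a : Λ} {Y : C} (hY : serreSub L (Set.Iic a) Y) (g : H.nabla a ⟶ Y)
    (h : Mono (H.ι a ≫ g)) : Mono g := by
  let g' : (⟨H.nabla a, H.nabla_mem a⟩ : (serreSub L (Set.Iic a)).FullSubcategory) ⟶ ⟨Y, hY⟩ :=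
    ObjectProperty.homMk g
  have := (H.isInjectiveHull a).essential g' ((serreSub L (Set.Iic a)).ι.mono_of_mono_map h)
  exact (serreSub L (Set.Iic a)).mono_hom_of_mono g'

lemma epi_of_epi_comp_π {a : Λ} {Y : C} (hY : serreSub L (Set.Iic a) Y) (g : Y ⟶ H.delta a)
    (h : Epi (g ≫ H.π a)) : Epi g := by
  let g' : (⟨Y, hY⟩ : (serreSub L (Set.Iic a)).FullSubcategory) ⟶ ⟨H.delta a, H.delta_mem a⟩ :=
    ObjectProperty.homMk g
  have := (H.isProjectiveCover a).essential g' ((serreSub L (Set.Iic a)).ι.epi_of_epi_map h)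
  exact (serreSub L (Set.Iic a)).epi_hom_of_epi g'

variable (hL : IsSimpleLabelling L)

include hL

/-- The image of f does not contain L(a), so L(a) still embeds in the cokernel of f; as L(a) is
essential in ∇(a), the projection to that cokernel is a monomorphism. -/
lemma hom_nabla_eq_zero {a : Λ} {X : C} (hX : serreSub L {a}ᶜ X) (f : X ⟶ H.nabla a) :
    f = 0 := by
  have := H.mono_ι a
  have := hL.simple a
  have hc : H.ι a ≫ cokernel.π f ≠ 0 := fun h0 => by
    let j : L a ⟶ Abelian.image f := kernel.lift (cokernel.π f) (H.ι a) h0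
    have : Mono j := mono_of_mono_fac (kernel.lift_ι (cokernel.π f) (H.ι a) h0)
    exact hL.serreSub_obj_iff.1 ((serreSub L {a}ᶜ).prop_of_mono j
      ((serreSub L {a}ᶜ).prop_of_epi (Abelian.factorThruImage f) hX)) rfl
  have := mono_of_nonzero_from_simple hc
  have := H.mono_of_mono_ι_comp ((serreSub L _).prop_of_epi (cokernel.π f) (H.nabla_mem a)) _ this
  rw [← cancel_mono (cokernel.π f), cokernel.condition, zero_comp]

lemma hom_delta_eq_zero {a : Λ} {X : C} (hX : serreSub L {a}ᶜ X) (f : H.delta a ⟶ X) :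
    f = 0 := by
  have := H.epi_π a
  have := hL.simple a
  have hc : kernel.ι f ≫ H.π a ≠ 0 := fun h0 => by
    let j : Abelian.coimage f ⟶ L a := cokernel.desc (kernel.ι f) (H.π a) h0
    have : Epi j := epi_of_epi_fac (cokernel.π_desc (kernel.ι f) (H.π a) h0)
    exact hL.serreSub_obj_iff.1 ((serreSub L {a}ᶜ).prop_of_epi j
      ((serreSub L {a}ᶜ).prop_of_mono (Abelian.factorThruCoimage f) hX)) rfl
  have := epi_of_nonzero_to_simple hc
  have := H.epi_of_epi_comp_π ((serreSub L _).prop_of_mono (kernel.ι f) (H.delta_mem a)) _ this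
  rw [← cancel_epi (kernel.ι f), kernel.condition, comp_zero]

omit hL

section Ext

variable [HasExt.{max u v} C]

lemma ext_one_nabla {Γ : Set Λ} (hf : Γ.Finite) (hΓ : IsLowerSet Γ) {a : Λ}
    (ha : Maximal (· ∈ Γ) a) {X : C} (hX : serreSub L Γ X) :
    Subsingleton (Ext.{max u v} X (H.nabla a) 1) :=
  Ext.subsingleton_one_of_split fun E f g w hS => by
    have := hS.mono_f
    have hn := serreSub_mono L (fun _ hb => hΓ hb ha.prop) (H.nabla_mem a)
    exact (serreSub L Γ).exists_extension_of_injective hn (H.injective_nabla a Γ hf hΓ ha)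
      ((serreSub L Γ).prop_X₂_of_shortExact hS hn hX) f (𝟙 _)

lemma ext_one_delta {a : Λ} {X : C} (hX : serreSub L (Set.Iic a) X) :
    Subsingleton (Ext.{max u v} (H.delta a) X 1) :=
  Ext.subsingleton_one_of_split' fun E f g w hS => by
    have := hS.epi_g
    exact (serreSub L (Set.Iic a)).exists_lift_of_projective (H.delta_mem a)
      (H.isProjectiveCover a).projective
      ((serreSub L _).prop_X₂_of_shortExact hS hX (H.delta_mem a)) g (𝟙 _)

lemma ext_one (a b : Λ) : Subsingleton (Ext.{max u v} (H.delta a) (H.nabla b) 1) := by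
  -- If b ≤ a, then ∇(b) lives where Δ(a) is projective. Otherwise b is maximal in the finite ideal
  -- generated by a and b, where ∇(b) is injective.
  by_cases hab : b ≤ a
  · exact H.ext_one_delta (serreSub_mono L (Set.Iic_subset_Iic.2 hab) (H.nabla_mem b))
  · refine H.ext_one_nabla ((H.lowerFinite a).union (H.lowerFinite b))
      ((isLowerSet_Iic a).union (isLowerSet_Iic b)) ⟨Or.inr le_rfl, fun c hc hbc => ?_⟩
      (serreSub_mono L Set.subset_union_left (H.delta_mem a))
    rcases hc with hc | hc
    · exact (hab (hbc.trans hc)).elim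
    · exact hc

lemma ext_two' (a b : Λ) : Subsingleton (Ext.{max u v} (H.delta a) (H.nabla b) 2) :=
  H.ext_two a b

end Ext

end LFHW.LowerFiniteHighestWeight

/-! ### Filtered extensions of costandard objects -/

namespace LFHW

open Abelian

/-- `IsFilteredExtension N i`: the morphism `i` is a composition of monomorphisms whose
cokernels belong to the family `N`. -/
inductive IsFilteredExtension {C : Type u} [Category.{v} C] [Abelian C] {Λ : Type s} (N : Λ → C)
    {Y : C} : ∀ {I : C}, (Y ⟶ I) → Prop
  | id : IsFilteredExtension N (𝟙 Y)
  | comp {I J : C} (i : Y ⟶ I) (f : I ⟶ J) (a : Λ) (g : J ⟶ N a) (w : f ≫ g = 0)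
      (hS : (ShortComplex.mk f g w).ShortExact) (hi : IsFilteredExtension N i) :
      IsFilteredExtension N (i ≫ f)

section

variable {C : Type u} [Category.{v} C] [Abelian C] {Λ : Type s} {L : Λ → C}

lemma IsFilteredExtension.subsingleton_ext [HasExt.{max u v} C] {N : Λ → C} {Y I : C} {i : Y ⟶ I}
    (h : IsFilteredExtension N i) {X : C} {n : ℕ} (hY : Subsingleton (Ext.{max u v} X Y n))
    (hN : ∀ a, Subsingleton (Ext.{max u v} X (N a) n)) :
    Subsingleton (Ext.{max u v} X I n) := by
  induction h with
  | id => exact hY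
  | comp i f a g w hS hi ih => exact Ext.subsingleton_middle_right hS ih (hN a)

lemma IsSimpleLabelling.subsingleton_ext [HasExt.{max u v} C]
    [∀ X : C, IsArtinianObject X] [∀ X : C, IsNoetherianObject X] (hL : IsSimpleLabelling L)
    {Ω : Set Λ} {Y : C} {n : ℕ} (h : ∀ a ∈ Ω, Subsingleton (Ext.{max u v} (L a) Y n))
    {X : C} (hX : serreSub L Ω X) : Subsingleton (Ext.{max u v} X Y n) := by
  let R : ObjectProperty C := fun X => Subsingleton (Ext.{max u v} X Y n)
  have : R.IsClosedUnderIsomorphisms := ⟨fun e h => Ext.subsingleton_of_iso e (Iso.refl Y) h⟩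
  exact hL.serreSub_induction R (fun X hX => Ext.subsingleton_of_isZero_left hX)
    (fun S hS h₁ h₃ => Ext.subsingleton_middle_left hS h₁ h₃) h hX

end

namespace LowerFiniteHighestWeight

variable {C : Type u} [Category.{v} C] [Abelian C] {Λ : Type s} [PartialOrder Λ] {L : Λ → C}
  (H : LowerFiniteHighestWeight L)

lemma shortExact_π (a : Λ) : (ShortComplex.mk (kernel.ι (H.π a)) (H.π a)
    (kernel.condition _)).ShortExact :=
  have := H.epi_π a
  ShortComplex.shortExact_kernel _

lemma shortExact_ι (a : Λ) : (ShortComplex.mk (H.ι a) (cokernel.π (H.ι a))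
    (cokernel.condition _)).ShortExact :=
  have := H.mono_ι a
  ShortComplex.shortExact_cokernel _

lemma kernel_π_mem (a : Λ) : serreSub L (Set.Iic a) (kernel (H.π a)) :=
  (serreSub L _).prop_of_mono (kernel.ι (H.π a)) (H.delta_mem a)

lemma cokernel_ι_mem (a : Λ) : serreSub L (Set.Iic a) (cokernel (H.ι a)) :=
  (serreSub L _).prop_of_epi (cokernel.π (H.ι a)) (H.nabla_mem a)

variable [∀ X : C, IsArtinianObject X] [∀ X : C, IsNoetherianObject X]
  (hL : IsSimpleLabelling L)

include hL

lemma cokernel_ι_mem_compl (a : Λ) : serreSub L {a}ᶜ (cokernel (H.ι a)) :=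
  have := H.mono_ι a
  hL.serreSub_cokernel_of_multiplicity_eq_one (H.multiplicity_nabla a) (H.ι a)

lemma cokernel_ι_mem_diff {Γ : Set Λ} (hΓ : IsLowerSet Γ) {a : Λ} (ha : a ∈ Γ) :
    serreSub L (Γ \ {a}) (cokernel (H.ι a)) := by
  refine hL.serreSub_of_forall_notMem fun b hb => ?_
  by_cases hba : b = a
  · exact hba ▸ H.cokernel_ι_mem_compl hL a
  · refine serreSub_mono L (fun c hc => ?_) (H.cokernel_ι_mem a)
    rintro rfl
    exact hb ⟨hΓ hc ha, hba⟩

variable [HasExt.{max u v} C]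

/-- For a ∈ Γ, the group Ext²(L(a), I) lies between Ext¹ of the kernel of Δ(a) → L(a), which is in
C_Γ, and Ext²(Δ(a), I). -/
lemma subsingleton_ext_two {Γ : Set Λ} (hΓ : IsLowerSet Γ) {I : C}
    (h₁ : ∀ X, serreSub L Γ X → Subsingleton (Ext.{max u v} X I 1))
    (h₂ : ∀ a, Subsingleton (Ext.{max u v} (H.delta a) I 2)) {X : C} (hX : serreSub L Γ X) :
    Subsingleton (Ext.{max u v} X I 2) :=
  hL.subsingleton_ext (fun a ha => Ext.subsingleton_quotient_left (n := 1) (H.shortExact_π a)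
    (h₁ _ (serreSub_mono L (fun _ hb => hΓ hb ha) (H.kernel_π_mem a))) (h₂ a)) hX

variable {k : Type t} [Field k] [Linear k C] [∀ X Y : C, Module.Finite k (X ⟶ Y)]

-- The connecting map presents Ext¹(L(a), I) as a quotient of the finite dimensional space of
-- morphisms from the kernel of Δ(a) → L(a) to I.
omit hL [∀ X : C, IsArtinianObject X] [∀ X : C, IsNoetherianObject X] in
variable (k) in
lemma finite_ext_one {I : C} {a : Λ} (h : Subsingleton (Ext.{max u v} (H.delta a) I 1)) :
    Module.Finite k (Ext.{max u v} (L a) I 1) := by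
  refine Module.Finite.of_surjective
    (((H.shortExact_π a).extClass.precompOfLinear k I (add_zero 1)).comp
      (Ext.linearEquiv₀ (R := k)).symm.toLinearMap) fun x => ?_
  obtain ⟨y, hy⟩ := Ext.contravariant_sequence_exact₃ (H.shortExact_π a) I x
    (Subsingleton.elim (α := Ext.{max u v} (H.delta a) I 1) _ _) (add_zero 1)
  refine ⟨Ext.linearEquiv₀ (R := k) y, ?_⟩
  simpa using hy

omit [∀ X : C, IsArtinianObject X] [∀ X : C, IsNoetherianObject X] hL [HasExt.{max u v} C]
  [∀ X Y : C, Module.Finite k (X ⟶ Y)] in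
lemma _root_.LinearMap.finrank_lt_of_surjective_of_mem_ker {V W : Type*} [AddCommGroup V]
    [Module k V] [AddCommGroup W] [Module k W] [Module.Finite k V] (f : V →ₗ[k] W)
    (hf : Function.Surjective f) {x : V} (hx : f x = 0) (hx0 : x ≠ 0) :
    Module.finrank k W < Module.finrank k V := by
  have h := f.finrank_range_add_finrank_ker
  have : Nontrivial (LinearMap.ker f) := ⟨⟨x, hx⟩, 0, fun h0 => hx0 (congrArg Subtype.val h0)⟩
  have := Module.finrank_pos (R := k) (M := LinearMap.ker f)
  rw [LinearMap.range_eq_top.2 hf, finrank_top] at h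
  omega

variable (k)

include k

/-- An object that is injective relative to a finite ideal without a maximal element `ν` has
a filtered extension that is injective relative to the whole ideal. -/
lemma exists_filteredExtension_of_maximal {Γ : Set Λ} (hf : Γ.Finite) (hΓ : IsLowerSet Γ) {ν : Λ}
    (hν : Maximal (· ∈ Γ) ν) {Y I : C} (i : Y ⟶ I) (hi : IsFilteredExtension H.nabla i)
    (hI₁ : ∀ a, Subsingleton (Ext.{max u v} (H.delta a) I 1))
    (hI₂ : ∀ a, Subsingleton (Ext.{max u v} (H.delta a) I 2))
    (hI : ∀ X, serreSub L (Γ \ {ν}) X → Subsingleton (Ext.{max u v} X I 1)) :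
    ∃ (J : C) (j : Y ⟶ J), IsFilteredExtension H.nabla j ∧
      ∀ X, serreSub L Γ X → Subsingleton (Ext.{max u v} X J 1) := by
  have hΓ' : IsLowerSet (Γ \ {ν}) := fun b a hab hb => ⟨hΓ hab hb.1, fun ha => by
    obtain rfl : a = ν := ha
    exact hb.2 (le_antisymm (hν.2 hb.1 hab) hab)⟩
  induction hn : Module.finrank k (Ext.{max u v} (L ν) I 1) using Nat.strong_induction_on
    generalizing I with
  | _ n ih =>
    by_cases hs : Subsingleton (Ext.{max u v} (L ν) I 1)
    · refine ⟨I, i, hi, fun X hX => hL.subsingleton_ext (fun a ha => ?_) hX⟩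
      by_cases h : a = ν
      · exact h ▸ hs
      · exact hI _ (serreSub_simple L ⟨ha, h⟩)
    · have hfin := H.finite_ext_one k (hI₁ ν)
      obtain ⟨e, he⟩ : ∃ e : Ext.{max u v} (L ν) I 1, e ≠ 0 := by
        by_contra! h
        exact hs (subsingleton_of_forall_eq 0 h)
      -- The obstruction to extending e to a class on ∇(ν) lies in Ext²(∇(ν)/L(ν), I). It vanishes
      -- because L(ν) occurs only once in ∇(ν), so the quotient is supported on Γ \ {ν}.
      obtain ⟨x, hx⟩ := Ext.contravariant_sequence_exact₁ (H.shortExact_ι ν) I e rfl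
        (@Subsingleton.elim _ (H.subsingleton_ext_two hL hΓ' hI hI₂
          (H.cokernel_ι_mem_diff hL hΓ hν.1)) _ _)
      obtain ⟨J, f, g, w, hS, hx'⟩ := Ext.exists_shortExact_extClass_eq x
      have hL1 : ∀ X, serreSub L Γ X → Subsingleton (Ext.{max u v} X (H.nabla ν) 1) :=
        fun X hX => H.ext_one_nabla hf hΓ hν hX
      refine ih _ ?_ (i ≫ f) (.comp i f ν g w hS hi)
        (fun a => Ext.subsingleton_middle_right hS (hI₁ a) (H.ext_one a ν))
        (fun a => Ext.subsingleton_middle_right hS (hI₂ a) (H.ext_two' a ν))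
        (fun X hX => Ext.subsingleton_middle_right hS (hI X hX)
          (hL1 X (serreSub_mono L Set.sdiff_subset hX))) rfl
      -- Ext¹(L(ν), I) maps onto Ext¹(L(ν), J), as Ext¹(L(ν), ∇(ν)) = 0, and e is in the kernel
      -- since J realises x; so the dimension drops.
      rw [← hn]
      refine LinearMap.finrank_lt_of_surjective_of_mem_ker
        ((Ext.mk₀ f).postcompOfLinear k (L ν) (add_zero 1)) (fun y => ?_) (x := e) ?_ he
      · exact Ext.covariant_sequence_exact₂ _ hS y
          (@Subsingleton.elim _ (hL1 _ (serreSub_simple L hν.1)) _ _)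
      · change e.comp (Ext.mk₀ f) (add_zero 1) = 0
        rw [← hx, ← hx', Ext.comp_assoc_of_third_deg_zero]
        exact (congrArg (fun z => (Ext.mk₀ (H.ι ν)).comp z (zero_add 1)) hS.extClass_comp).trans
          (Ext.comp_zero _ _ _ _ _)

/-- Every `∇(μ)` has a filtered extension that is injective relative to a given finite ideal. -/
theorem exists_filteredExtension {Γ : Set Λ} (hf : Γ.Finite) (hΓ : IsLowerSet Γ) {μ : Λ}
    (hμ : μ ∈ Γ) :
    ∃ (I : C) (i : H.nabla μ ⟶ I), IsFilteredExtension H.nabla i ∧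
      ∀ X, serreSub L Γ X → Subsingleton (Ext.{max u v} X I 1) := by
  induction hn : Γ.ncard using Nat.strong_induction_on generalizing Γ with
  | _ n ih =>
    -- Elements not below μ are added one maximal element at a time. If there are none, μ is the
    -- largest element of Γ and ∇(μ) itself is relatively injective.
    by_cases hne : (Γ \ Set.Iic μ).Nonempty
    · obtain ⟨ν, hν⟩ := hf.sdiff.exists_maximal hne
      have hmax : ∀ b ∈ Γ, ν ≤ b → b ≤ ν := fun b hb hνb =>
        hν.2 ⟨hb, fun hbμ => hν.1.2 (hνb.trans hbμ)⟩ hνb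
      have hΓ' : IsLowerSet (Γ \ {ν}) := fun b a hab hb => ⟨hΓ hab hb.1, fun ha => by
        obtain rfl : a = ν := ha
        exact hb.2 (le_antisymm (hmax b hb.1 hab) hab)⟩
      obtain ⟨I, i, hi, hI⟩ := ih (Γ \ {ν}).ncard
        (hn ▸ Set.ncard_sdiff_singleton_lt_of_mem hν.1.1 hf) hf.sdiff hΓ'
        ⟨hμ, fun h => hν.1.2 (h ▸ le_rfl)⟩ rfl
      exact H.exists_filteredExtension_of_maximal hL k hf hΓ
        ⟨hν.1.1, fun b hb => hmax b hb⟩ i hi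
        (fun a => hi.subsingleton_ext (H.ext_one a μ) (H.ext_one a))
        (fun a => hi.subsingleton_ext (H.ext_two' a μ) (H.ext_two' a)) hI
    · have hle : ∀ b ∈ Γ, b ≤ μ := fun b hb => by
        by_contra h
        exact hne ⟨b, hb, h⟩
      exact ⟨_, 𝟙 _, .id, fun X hX => H.ext_one_nabla hf hΓ ⟨hμ, fun b hb _ => hle b hb⟩ hX⟩

end LowerFiniteHighestWeight

end LFHW

/-! ### Degree one extensions in a Serre quotient -/

namespace CategoryTheory.ObjectProperty

open Abelian

universe w w' v' u'

section

variable {C : Type u} [Category.{v} C] [Abelian C] (P : ObjectProperty C) [P.IsSerreClass]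
  [HasExt.{w} C] {N : C}
  (hN₀ : ∀ X, P X → Subsingleton (Ext.{w} X N 0))
  (hN₁ : ∀ X, P X → Subsingleton (Ext.{w} X N 1))
  (hN₂ : ∀ X, P X → Subsingleton (Ext.{w} X N 2))

include hN₀ hN₁ hN₂

/-- Factor s through its image. Passing from A to B uses vanishing in degrees 0 and 1 on the Serre
class, passing back uses degrees 1 and 2. -/
lemma subsingleton_ext_one_iff_of_isoModSerre {A B : C} {s : A ⟶ B} (hs : P.isoModSerre s) :
    Subsingleton (Ext.{w} A N 1) ↔ Subsingleton (Ext.{w} B N 1) := by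
  have h₁ := ShortComplex.shortExact_kernel (Abelian.factorThruImage s)
  have h₂ := ShortComplex.shortExact_cokernel (Abelian.image.ι s)
  have hk : P (kernel (Abelian.factorThruImage s)) :=
    ((P.isoModSerre_iff_of_epi _).1 (monoModSerre.isoModSerre_factorThruImage hs.1))
  have hc : P (cokernel (Abelian.image.ι s)) :=
    ((P.isoModSerre_iff_of_mono _).1 (epiModSerre.isoModSerre_image_ι hs.2))
  refine ⟨fun h => ?_, fun h => ?_⟩
  · exact Ext.subsingleton_middle_left h₂
      (Ext.subsingleton_quotient_left (n := 0) h₁ (hN₀ _ hk) h) (hN₁ _ hc)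
  · exact Ext.subsingleton_middle_left h₁ (hN₁ _ hk)
      (Ext.subsingleton_sub_left (n := 1) h₂ h (hN₂ _ hc))

variable {D : Type u'} [Category.{v'} D] [Abelian D] (G : C ⥤ D) [G.Additive]
  [G.IsLocalization P.isoModSerre]

lemma subsingleton_ext_one_of_map_iso {X F : C} (e : G.obj F ≅ G.obj X)
    (h : Subsingleton (Ext.{w} X N 1)) : Subsingleton (Ext.{w} F N 1) := by
  obtain ⟨φ, hφ⟩ := Localization.exists_leftFraction G P.isoModSerre e.hom
  have := Localization.inverts G P.isoModSerre _ φ.hs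
  have h1 : e.hom ≫ G.map φ.s = G.map φ.f := by
    rw [hφ, MorphismProperty.LeftFraction.map_comp_map_s]
  have h2 : P.isoModSerre φ.f := by
    rw [← SerreClassLocalization.isIso_map_iff G P, ← h1]
    infer_instance
  rw [subsingleton_ext_one_iff_of_isoModSerre P hN₀ hN₁ hN₂ h2,
    ← subsingleton_ext_one_iff_of_isoModSerre P hN₀ hN₁ hN₂ φ.hs]
  exact h

end

section

variable {C : Type u} [Category.{v} C] [Abelian C] (P : ObjectProperty C) [P.IsSerreClass]
  {D : Type u'} [Category.{v'} D] [Abelian D] (G : C ⥤ D) [G.Additive]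
  [G.IsLocalization P.isoModSerre] {N : C} (hN₀ : ∀ X, P X → ∀ f : X ⟶ N, f = 0)

include hN₀

/-- A monomorphism in the quotient category out of (the image of) an object without nonzero
morphisms from the Serre class lifts to a monomorphism. -/
lemma exists_mono_lift_of_localization {E : D} (g : G.obj N ⟶ E) [Mono g] :
    ∃ (E' : C) (f : N ⟶ E') (e : E ≅ G.obj E'), Mono f ∧ g ≫ e.hom = G.map f := by
  have := Localization.essSurj G P.isoModSerre
  obtain ⟨φ, hφ⟩ := Localization.exists_leftFraction G P.isoModSerre
    (g ≫ (G.objObjPreimageIso E).inv)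
  have := Localization.inverts G P.isoModSerre _ φ.hs
  have h1 : g ≫ (G.objObjPreimageIso E).inv ≫ G.map φ.s = G.map φ.f := by
    rw [← Category.assoc, hφ, MorphismProperty.LeftFraction.map_comp_map_s]
  refine ⟨φ.Y', φ.f, (G.objObjPreimageIso E).symm ≪≫ asIso (G.map φ.s), ?_, h1⟩
  have hm : Mono (G.map φ.f) := by rw [← h1]; infer_instance
  rw [SerreClassLocalization.mono_map_iff G P] at hm
  -- The kernel of the numerator is in the Serre class, so its inclusion into N is zero.
  exact Preadditive.mono_of_kernel_zero (hN₀ _ hm _)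

end

variable {C : Type u} [Category.{v} C] [Abelian C] (P : ObjectProperty C) [P.IsSerreClass]
  {D : Type u'} [Category.{v'} D] [Abelian D] (G : C ⥤ D) [G.Additive]
  [G.IsLocalization P.isoModSerre] [HasExt.{w} C] [HasExt.{w'} D] {N : C}
  (hN₀ : ∀ X, P X → Subsingleton (Ext.{w} X N 0))
  (hN₁ : ∀ X, P X → Subsingleton (Ext.{w} X N 1))
  (hN₂ : ∀ X, P X → Subsingleton (Ext.{w} X N 2))

include hN₀ hN₁ hN₂

/-- The inclusion in an extension of G X by G N lifts to a monomorphism f out of N. The cokernel of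
f agrees with X in the quotient, hence has no extensions by N, and f splits already in C. -/
lemma subsingleton_ext_one_localization {X : C} (h : Subsingleton (Ext.{w} X N 1)) :
    Subsingleton (Ext.{w'} (G.obj X) (G.obj N) 1) := by
  have := SerreClassLocalization.preservesFiniteLimits G P
  have := SerreClassLocalization.preservesFiniteColimits G P
  refine Ext.subsingleton_one_of_split fun E g p w hS => ?_
  have := hS.mono_f
  obtain ⟨E', f, e, _, hf⟩ := exists_mono_lift_of_localization P G
    (fun X hX => Ext.subsingleton_zero_iff.1 (hN₀ X hX)) g
  let α : Arrow.mk (G.map f) ≅ Arrow.mk g :=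
    Arrow.isoMk (Iso.refl _) e.symm (by simp [← hf])
  have e' : G.obj (cokernel f) ≅ G.obj X :=
    CokernelCofork.mapIsoOfIsColimit
      ((ShortComplex.shortExact_cokernel f).map_of_exact G).gIsCokernel hS.gIsCokernel α
  obtain ⟨r, hr⟩ := Ext.exists_extension_of_mono f
    (subsingleton_ext_one_of_map_iso P hN₀ hN₁ hN₂ G e' h) (𝟙 N)
  refine ⟨e.hom ≫ G.map r, ?_⟩
  rw [reassoc_of% hf, ← G.map_comp, hr, G.map_id]

end CategoryTheory.ObjectProperty

/-! ### Quotients by ideals for the essential order -/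

namespace LFHW.LowerFiniteHighestWeight

open Abelian CategoryTheory.ObjectProperty

universe w' v' u'

variable {C : Type u} [Category.{v} C] [Abelian C] {Λ : Type s} [PartialOrder Λ] {L : Λ → C}
  (H : LowerFiniteHighestWeight L)
  [∀ X : C, IsArtinianObject X] [∀ X : C, IsNoetherianObject X]
  (hL : IsSimpleLabelling L) {Ω : Set Λ} (hΩ : H.IsEssIdeal Ω)

include hL

include H in
lemma exists_finite_isLowerSet_serreSub (X : C) :
    ∃ Γ : Set Λ, Γ.Finite ∧ IsLowerSet Γ ∧ serreSub L Γ X := by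
  let R : ObjectProperty C := fun X => ∃ Γ : Set Λ, Γ.Finite ∧ IsLowerSet Γ ∧ serreSub L Γ X
  have : R.IsClosedUnderIsomorphisms := ⟨fun e ⟨Γ, h₁, h₂, h₃⟩ =>
    ⟨Γ, h₁, h₂, ObjectProperty.prop_of_iso _ e h₃⟩⟩
  refine finiteLength_induction R (fun X hX => ⟨∅, Set.finite_empty, isLowerSet_empty,
    ObjectProperty.prop_of_isZero _ hX⟩) (fun S hS hs ⟨Γ, h₁, h₂, h₃⟩ => ?_) X
  obtain ⟨a, ⟨e⟩⟩ := hL.exists_iso _ hs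
  exact ⟨Γ ∪ Set.Iic a, h₁.union (H.lowerFinite a), h₂.union (isLowerSet_Iic a),
    ObjectProperty.prop_X₂_of_shortExact _ hS (serreSub_mono L Set.subset_union_left h₃)
      (ObjectProperty.prop_of_iso _ e.symm (serreSub_simple L (Or.inr le_rfl)))⟩

include hΩ

lemma delta_mem_of_isEssIdeal {a : Λ} (ha : a ∈ Ω) : serreSub L Ω (H.delta a) :=
  hL.serreSub_of_forall_notMem fun b hb => by
    rw [← hL.multiplicity_eq_zero_iff]
    by_contra h
    exact hb (hΩ a ha b (.single (Or.inl h)))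

lemma nabla_mem_of_isEssIdeal {a : Λ} (ha : a ∈ Ω) : serreSub L Ω (H.nabla a) :=
  hL.serreSub_of_forall_notMem fun b hb => by
    rw [← hL.multiplicity_eq_zero_iff]
    by_contra h
    exact hb (hΩ a ha b (.single (Or.inr h)))

section

variable [HasExt.{max u v} C]

omit [∀ X : C, IsArtinianObject X] [∀ X : C, IsNoetherianObject X] hΩ in
lemma subsingleton_ext_nabla_zero {b : Λ} (hb : b ∉ Ω) {X : C} (hX : serreSub L Ω X) :
    Subsingleton (Ext.{max u v} X (H.nabla b) 0) :=
  Ext.subsingleton_zero_iff.2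
    (H.hom_nabla_eq_zero hL (serreSub_mono L (fun c hc => by rintro rfl; exact hb hc) hX))

/-- Dimension shift along Δ(a) → L(a). The ideal property enters here: it keeps the kernel inside
C_Ω. -/
lemma subsingleton_ext_nabla_succ {b : Λ} {n : ℕ}
    (h₀ : ∀ X, serreSub L Ω X → Subsingleton (Ext.{max u v} X (H.nabla b) n))
    (h₁ : ∀ a, Subsingleton (Ext.{max u v} (H.delta a) (H.nabla b) (n + 1)))
    {X : C} (hX : serreSub L Ω X) :
    Subsingleton (Ext.{max u v} X (H.nabla b) (n + 1)) :=
  hL.subsingleton_ext (fun a ha => Ext.subsingleton_quotient_left (H.shortExact_π a)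
    (h₀ _ ((serreSub L Ω).prop_of_mono (kernel.ι (H.π a)) (H.delta_mem_of_isEssIdeal hL hΩ ha)))
    (h₁ a)) hX

lemma subsingleton_ext_nabla_one {b : Λ} (hb : b ∉ Ω) {X : C} (hX : serreSub L Ω X) :
    Subsingleton (Ext.{max u v} X (H.nabla b) 1) :=
  H.subsingleton_ext_nabla_succ hL hΩ (fun _ h => H.subsingleton_ext_nabla_zero hL hb h)
    (fun a => H.ext_one a b) hX

lemma subsingleton_ext_nabla_two {b : Λ} (hb : b ∉ Ω) {X : C} (hX : serreSub L Ω X) :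
    Subsingleton (Ext.{max u v} X (H.nabla b) 2) :=
  H.subsingleton_ext_nabla_succ hL hΩ (fun _ h => H.subsingleton_ext_nabla_one hL hΩ hb h)
    (fun a => H.ext_two' a b) hX

end

variable {D : Type u'} [Category.{v'} D] [Abelian D] (G : C ⥤ D) [G.Additive]
  [G.IsLocalization (serreSub L Ω).isoModSerre] [HasExt.{w'} D]

lemma subsingleton_ext_one_map_nabla {b : Λ} (hb : b ∉ Ω) [HasExt.{max u v} C] {X : C}
    (h : Subsingleton (Ext.{max u v} X (H.nabla b) 1)) :
    Subsingleton (Ext.{w'} (G.obj X) (G.obj (H.nabla b)) 1) :=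
  subsingleton_ext_one_localization (serreSub L Ω) G
    (fun _ hX => H.subsingleton_ext_nabla_zero hL hb hX)
    (fun _ hX => H.subsingleton_ext_nabla_one hL hΩ hb hX)
    (fun _ hX => H.subsingleton_ext_nabla_two hL hΩ hb hX) h

-- At each step of the filtration, the kernel on Ext in degree n + 1 comes from Ext^n(Z, G N(a)) =
-- 0.
omit hL hΩ [∀ X : C, IsArtinianObject X] [∀ X : C, IsNoetherianObject X] [PartialOrder Λ]
  [G.IsLocalization (serreSub L Ω).isoModSerre] in
lemma _root_.LFHW.IsFilteredExtension.eq_zero_of_comp_map_eq_zero [PreservesFiniteLimits G]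
    [PreservesFiniteColimits G] {N : Λ → C} {Y I : C} {i : Y ⟶ I} (hi : IsFilteredExtension N i)
    {Z : D} {n : ℕ} (hN : ∀ a, Subsingleton (Ext.{w'} Z (G.obj (N a)) n))
    (x : Ext.{w'} Z (G.obj Y) (n + 1)) (hx : x.comp (Ext.mk₀ (G.map i)) (add_zero _) = 0) :
    x = 0 := by
  induction hi with
  | id => simpa using hx
  | comp i f a g w hS hi ih =>
    apply ih
    rw [G.map_comp, ← Ext.mk₀_comp_mk₀, ← Ext.comp_assoc_of_third_deg_zero] at hx
    obtain ⟨y, hy⟩ := Ext.covariant_sequence_exact₁ _ (hS.map_of_exact G) _ hx rfl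
    rw [← hy, @Subsingleton.elim _ (hN a) y 0]
    exact Ext.zero_comp Z n (hS.map_of_exact G).extClass (n + 1) rfl

variable (k : Type t) [Field k] [Linear k C] [∀ X Y : C, Module.Finite k (X ⟶ Y)]

include k

/-- There are no higher extensions between the images of standard and costandard objects in the
quotient by an ideal for the essential order. -/
theorem subsingleton_ext_map_delta_map_nabla (a b : Λ) (n : ℕ) :
    Subsingleton (Ext.{w'} (G.obj (H.delta a)) (G.obj (H.nabla b)) (n + 1)) := by
  have := HasExt.standard C
  have := SerreClassLocalization.preservesFiniteLimits G (serreSub L Ω)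
  have := SerreClassLocalization.preservesFiniteColimits G (serreSub L Ω)
  induction n generalizing b with
  | zero =>
    by_cases hb : b ∈ Ω
    · exact Ext.subsingleton_of_isZero_right
        ((SerreClassLocalization.isZero_obj_iff G (serreSub L Ω) _).2
          (H.nabla_mem_of_isEssIdeal hL hΩ hb))
    · exact H.subsingleton_ext_one_map_nabla hL hΩ G hb (H.ext_one a b)
  | succ n ih =>
    by_cases hb : b ∈ Ω
    · exact Ext.subsingleton_of_isZero_right
        ((SerreClassLocalization.isZero_obj_iff G (serreSub L Ω) _).2
          (H.nabla_mem_of_isEssIdeal hL hΩ hb))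
    refine subsingleton_of_forall_eq 0 fun x => ?_
    obtain ⟨Z, j, _, hj⟩ := Ext.exists_mono_comp_mk₀_eq_zero x
    obtain ⟨E, f, e, _, hf⟩ := exists_mono_lift_of_localization (serreSub L Ω) G
      (fun X hX => Ext.subsingleton_zero_iff.1 (H.subsingleton_ext_nabla_zero hL hb hX)) j
    obtain ⟨Γ, hΓ, hΓ', hE⟩ := H.exists_finite_isLowerSet_serreSub hL E
    obtain ⟨I, i, hi, hI⟩ := H.exists_filteredExtension hL k (hΓ.union (H.lowerFinite b))
      (hΓ'.union (isLowerSet_Iic b)) (Or.inr le_rfl)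
    -- By relative injectivity of I, the embedding i factors through the lift f of the effacing
    -- monomorphism, so G i kills x as well.
    obtain ⟨q, hq⟩ := Ext.exists_extension_of_mono f (hI _ (ObjectProperty.prop_of_epi _
      (cokernel.π f) (serreSub_mono L Set.subset_union_left hE))) i
    refine hi.eq_zero_of_comp_map_eq_zero G ih x ?_
    rw [← hq, G.map_comp, ← hf, ← Ext.mk₀_comp_mk₀, ← Ext.mk₀_comp_mk₀,
      ← Ext.comp_assoc_of_third_deg_zero, ← Ext.comp_assoc_of_third_deg_zero, hj, Ext.zero_comp,
      Ext.zero_comp]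

theorem subsingleton_ext_map_simple {a : Λ} (hK : serreSub L Ω (kernel (H.π a)))
    (hQ : serreSub L Ω (cokernel (H.ι a))) (n : ℕ) :
    Subsingleton (Ext.{w'} (G.obj (L a)) (G.obj (L a)) (n + 1)) := by
  have := H.mono_ι a
  have := H.epi_π a
  have : IsIso (G.map (H.ι a)) := (SerreClassLocalization.isIso_map_iff G (serreSub L Ω) _).2
    ((serreSub L Ω).isoModSerre_of_mono _ hQ)
  have : IsIso (G.map (H.π a)) := (SerreClassLocalization.isIso_map_iff G (serreSub L Ω) _).2
    ((serreSub L Ω).isoModSerre_of_epi _ hK)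
  exact Ext.subsingleton_of_iso (asIso (G.map (H.π a))) (asIso (G.map (H.ι a))).symm
    (H.subsingleton_ext_map_delta_map_nabla hL hΩ G k a a n)

omit k

omit hΩ [HasExt.{w'} D] in
lemma hom_map_delta_map_cokernel_eq_zero {a : Λ} (ha : a ∉ Ω)
    (g : G.obj (H.delta a) ⟶ G.obj (cokernel (H.ι a))) : g = 0 := by
  obtain ⟨φ, hφ⟩ := Localization.exists_leftFraction G (serreSub L Ω).isoModSerre g
  have := Localization.inverts G (serreSub L Ω).isoModSerre _ φ.hs
  have h1 : g ≫ G.map φ.s = G.map φ.f := by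
    rw [hφ, MorphismProperty.LeftFraction.map_comp_map_s]
  -- The target of the fraction is built from a quotient of ∇(a)/L(a) and an object of C_Ω, neither
  -- having L(a) as a factor; so Δ(a) has no nonzero map to it.
  have hs : serreSub L {a}ᶜ φ.Y' :=
    (serreSub L {a}ᶜ).prop_X₂_of_exact (ShortComplex.exact_cokernel φ.s)
      (H.cokernel_ι_mem_compl hL a)
      (serreSub_mono L (fun c hc => by rintro rfl; exact ha hc) φ.hs.2)
  rw [← cancel_mono (G.map φ.s), h1, H.hom_delta_eq_zero hL hs φ.f, G.map_zero, zero_comp]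

lemma hom_map_kernel_map_cokernel_eq_zero {a : Λ} (ha : a ∉ Ω)
    (h : Subsingleton (Ext.{w'} (G.obj (L a)) (G.obj (L a)) 2))
    (g : G.obj (kernel (H.π a)) ⟶ G.obj (cokernel (H.ι a))) : g = 0 := by
  have := HasExt.standard C
  have := SerreClassLocalization.preservesFiniteLimits G (serreSub L Ω)
  have := SerreClassLocalization.preservesFiniteColimits G (serreSub L Ω)
  have h₁ : Subsingleton (Ext.{w'} (G.obj (L a)) (G.obj (H.nabla a)) 1) :=
    H.subsingleton_ext_one_map_nabla hL hΩ G ha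
      (H.ext_one_nabla (H.lowerFinite a) (isLowerSet_Iic a) ⟨le_rfl, fun b hb _ => hb⟩
        (serreSub_simple L Set.self_mem_Iic))
  have h₂ : Subsingleton (Ext.{w'} (G.obj (L a)) (G.obj (cokernel (H.ι a))) 1) :=
    Ext.subsingleton_quotient_right ((H.shortExact_ι a).map_of_exact G) h₁ h
  obtain ⟨y, hy⟩ := Ext.contravariant_sequence_exact₁ ((H.shortExact_π a).map_of_exact G) _
    (Ext.mk₀.{w'} g) (add_zero 1) (@Subsingleton.elim _ h₂ _ _)
  obtain ⟨g', rfl⟩ := Ext.addEquiv₀.symm.surjective y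
  rw [show g' = 0 from H.hom_map_delta_map_cokernel_eq_zero hL G ha g', map_zero,
    Ext.comp_zero] at hy
  exact (Ext.mk₀_eq_zero_iff.{w'} g).1 hy.symm

end LFHW.LowerFiniteHighestWeight

/-! ### Consequences of the duality -/

namespace LFHW

open Opposite

section

variable {C : Type u} [Category.{v} C] [Abelian C] {Λ : Type s} {L : Λ → C}

lemma serreSub_map_op (F : Cᵒᵖ ⥤ C) [F.PreservesZeroMorphisms] [PreservesFiniteLimits F]
    [PreservesFiniteColimits F] (hF : ∀ a, Nonempty (F.obj (op (L a)) ≅ L a)) {Ω : Set Λ}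
    {X : C} (hX : serreSub L Ω X) : serreSub L Ω (F.obj (op X)) := by
  let P : ObjectProperty C := fun X => serreSub L Ω (F.obj (op X))
  have : P.IsSerreClass :=
    { exists_zero := ⟨0, isZero_zero C, (serreSub L Ω).prop_of_isZero
        (F.map_isZero (isZero_zero C).op)⟩
      prop_of_mono := fun f _ h => (serreSub L Ω).prop_of_epi (F.map f.op) h
      prop_of_epi := fun f _ h => (serreSub L Ω).prop_of_mono (F.map f.op) h
      prop_X₂_of_shortExact := fun hS h₁ h₃ =>
        (serreSub L Ω).prop_X₂_of_shortExact (hS.op.map_of_exact F) h₃ h₁ }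
  exact hX P this fun a ha =>
    (serreSub L Ω).prop_of_iso (hF a).some.symm (serreSub_simple L ha)

end

namespace LowerFiniteHighestWeight

variable {C : Type u} [Category.{v} C] [Abelian C] {Λ : Type s} [PartialOrder Λ] {L : Λ → C}
  (H : LowerFiniteHighestWeight L)
  (Ψ : Cᵒᵖ ≌ C) (hΨ : ∀ a : Λ, Nonempty (Ψ.functor.obj (op (L a)) ≅ L a))

include hΨ

/-- The duality exchanges Δ(a) and ∇(a), compatibly with their maps to and from L(a). With Δ' the
preimage of Δ(a) under Ψ, injectivity of ∇(a) gives h : Δ' → ∇(a); projectivity of Δ(a) gives a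
retraction of h, which is a monomorphism because L(a) is essential in ∇(a). Hence h is invertible.
-/
lemma nonempty_kernel_π_iso (a : Λ) :
    Nonempty (kernel (H.π a) ≅ Ψ.functor.obj (op (cokernel (H.ι a)))) := by
  have := H.epi_π a
  have := H.mono_ι a
  let F := Ψ.functor
  obtain ⟨θ⟩ := hΨ a
  let Ψ' : Cᵒᵖ ≌ C := Ψ.symm.op.trans (opOpEquivalence C)
  have hΨ' : ∀ a : Λ, Nonempty (Ψ'.functor.obj (op (L a)) ≅ L a) := fun a =>
    ⟨((Ψ.unitIso.app (op (L a)) ≪≫ Ψ.inverse.mapIso (hΨ a).some).unop)⟩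
  let Δ' : C := Ψ'.functor.obj (op (H.delta a))
  have hΔ' : serreSub L (Set.Iic a) Δ' := serreSub_map_op Ψ'.functor hΨ' (H.delta_mem a)
  let e : F.obj (op Δ') ≅ H.delta a := Ψ.counitIso.app (H.delta a)
  obtain ⟨m, hm⟩ : ∃ m : op Δ' ⟶ op (L a), F.map m = e.hom ≫ H.π a ≫ θ.inv :=
    F.map_surjective _
  have hme : Epi m := F.epi_of_epi_map (by rw [hm]; infer_instance)
  have : Mono m.unop := inferInstance
  obtain ⟨h, hh⟩ := (serreSub L (Set.Iic a)).exists_extension_of_injective (H.nabla_mem a)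
    (H.isInjectiveHull a).injective hΔ' m.unop (H.ι a)
  let p' : F.obj (op (H.nabla a)) ⟶ L a := F.map (H.ι a).op ≫ θ.hom
  have hp' : Epi p' := inferInstance
  let v : F.obj (op (H.nabla a)) ⟶ H.delta a := F.map h.op ≫ e.hom
  have hv : v ≫ H.π a = p' := by
    have : F.map h.op ≫ F.map m = F.map (H.ι a).op := by
      rw [← F.map_comp, ← hh]; rfl
    rw [hm] at this
    rw [← cancel_mono θ.inv]
    simpa [v, p'] using this
  have hFn : serreSub L (Set.Iic a) (F.obj (op (H.nabla a))) :=
    serreSub_map_op F hΨ (H.nabla_mem a)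
  have hve : Epi v := H.epi_of_epi_comp_π hFn v (by rw [hv]; exact hp')
  obtain ⟨w, hw⟩ := (serreSub L (Set.Iic a)).exists_lift_of_projective (H.delta_mem a)
    (H.isProjectiveCover a).projective hFn v (𝟙 _)
  obtain ⟨r, hr⟩ : ∃ r : op Δ' ⟶ op (H.nabla a), F.map r = e.hom ≫ w := F.map_surjective _
  have hrh : r ≫ h.op = 𝟙 _ := F.map_injective (by
    rw [F.map_comp, hr, F.map_id, ← cancel_mono e.hom]
    simpa [v] using congrArg (e.hom ≫ ·) hw)
  have hrh' : h ≫ r.unop = 𝟙 _ := congrArg Quiver.Hom.unop hrh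
  have : Mono r.unop := H.mono_of_mono_ι_comp hΔ' r.unop (by
    rw [← hh, Category.assoc, hrh', Category.comp_id]; infer_instance)
  have : IsIso h := ⟨r.unop, hrh', by
    rw [← cancel_mono r.unop, Category.assoc, hrh']; simp⟩
  have : IsIso v := inferInstance
  have hS := (H.shortExact_ι a).op.map_of_exact F
  have hv' : F.map (H.ι a).op = v ≫ H.π a ≫ θ.inv := by
    rw [← Category.assoc, hv, Category.assoc, Iso.hom_inv_id, Category.comp_id]
  exact ⟨KernelFork.mapIsoOfIsLimit (H.shortExact_π a).fIsKernel hS.fIsKernel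
    (Arrow.isoMk (asIso v).symm θ.symm
      ((IsIso.inv_comp_eq v).2 hv'))⟩

lemma kernel_π_mem_of_cokernel_ι_mem {Ω : Set Λ} {a : Λ} (h : serreSub L Ω (cokernel (H.ι a))) :
    serreSub L Ω (kernel (H.π a)) :=
  (serreSub L Ω).prop_of_iso (H.nonempty_kernel_π_iso Ψ hΨ a).some.symm
    (serreSub_map_op Ψ.functor hΨ h)

universe v' u'

lemma exists_hom_map_kernel_map_cokernel_ne_zero [∀ X : C, IsArtinianObject X]
    [∀ X : C, IsNoetherianObject X] (hL : IsSimpleLabelling L) {Ω : Set Λ}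
    {D : Type u'} [Category.{v'} D] [Abelian D] (G : C ⥤ D) [G.Additive]
    [G.IsLocalization (serreSub L Ω).isoModSerre] {a : Λ}
    (h : ¬ serreSub L Ω (cokernel (H.ι a))) :
    ∃ g : G.obj (kernel (H.π a)) ⟶ G.obj (cokernel (H.ι a)), g ≠ 0 := by
  have := ObjectProperty.SerreClassLocalization.preservesFiniteLimits G (serreSub L Ω)
  have := ObjectProperty.SerreClassLocalization.preservesFiniteColimits G (serreSub L Ω)
  have hzero := ObjectProperty.SerreClassLocalization.isZero_obj_iff G (serreSub L Ω)
  obtain ⟨A, i, _, hA, hmax⟩ := (serreSub L Ω).exists_maximal_mono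
    (fun X hX => (serreSub L Ω).prop_of_isZero hX) (cokernel (H.ι a))
  have hi : ¬ IsZero (cokernel i) := fun hi =>
    have : Epi i := Preadditive.epi_of_isZero_cokernel i hi
    h ((serreSub L Ω).prop_of_epi i hA)
  obtain ⟨Y, hY⟩ := exists_simple_subobject hi
  have hS := ShortComplex.shortExact_cokernel i
  have hY' : ¬ serreSub L Ω (Y : C) := fun h' =>
    hmax _ Y.arrow inferInstance (Simple.not_isZero _)
      ((serreSub L Ω).prop_X₂_of_shortExact (hS.pullback Y.arrow) hA h')
  obtain ⟨b, ⟨e⟩⟩ := hL.exists_iso _ hY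
  let F := Ψ.functor
  let e' : F.obj (op (Y : C)) ≅ Y := F.mapIso e.symm.op ≪≫ (hΨ b).some ≪≫ e.symm
  obtain ⟨θ⟩ := H.nonempty_kernel_π_iso Ψ hΨ a
  have h₁ : IsIso (G.map (cokernel.π i)) :=
    (hS.map_of_exact G).isIso_g_iff.2 ((hzero _).2 hA)
  have h₂ : IsIso (G.map (F.map (cokernel.π i).op)) :=
    ((hS.op.map_of_exact F).map_of_exact G).isIso_f_iff.2
      ((hzero _).2 (serreSub_map_op F hΨ hA))
  -- A simple Y in the quotient of Q by a maximal subobject from C_Ω is not in C_Ω. The map is an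
  -- epimorphism onto G(Y) followed by a monomorphism, so it vanishes only if G(Y) does.
  refine ⟨G.map θ.hom ≫ inv (G.map (F.map (cokernel.π i).op)) ≫ G.map (F.map Y.arrow.op) ≫
    G.map e'.hom ≫ G.map Y.arrow ≫ inv (G.map (cokernel.π i)), fun h0 => hY' ?_⟩
  have : Epi (F.map Y.arrow.op) := inferInstance
  have : Epi (G.map (F.map Y.arrow.op)) := inferInstance
  rw [← hzero, IsZero.iff_id_eq_zero, ← cancel_mono (G.map Y.arrow),
    ← cancel_mono (inv (G.map (cokernel.π i))), ← cancel_epi (G.map e'.hom),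
    ← cancel_epi (G.map (F.map Y.arrow.op)),
    ← cancel_epi (inv (G.map (F.map (cokernel.π i).op))), ← cancel_epi (G.map θ.hom)]
  simpa using h0

end LowerFiniteHighestWeight

end LFHW

/-! ### Adding elements to ideals, enumerations and lengths -/

namespace LFHW

open Abelian Opposite

namespace LowerFiniteHighestWeight

variable {C : Type u} [Category.{v} C] [Abelian C] {Λ : Type s} [PartialOrder Λ] {L : Λ → C}
  (H : LowerFiniteHighestWeight L)

lemma isEssIdeal_empty : H.IsEssIdeal ∅ := fun _ h => h.elim

lemma isEssIdeal_of_step {Ω : Set Λ} (h : ∀ a ∈ Ω, ∀ b, multiplicity (H.delta a) (L b) ≠ 0 ∨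
    multiplicity (H.nabla a) (L b) ≠ 0 → b ∈ Ω) : H.IsEssIdeal Ω := fun a ha b hb => by
  induction hb using Relation.ReflTransGen.head_induction_on with
  | refl => exact ha
  | head h' _ ih => exact h _ ih _ h'

lemma isEssIdeal_singleton_iff {a : Λ} : H.IsEssIdeal {a} ↔ H.IsEssMin a :=
  ⟨fun h b hb => h a rfl b hb, fun h x hx b hb => h b (by rwa [← show x = a from hx])⟩

variable [∀ X : C, IsArtinianObject X] [∀ X : C, IsNoetherianObject X]
  (hL : IsSimpleLabelling L)

include hL

lemma le_of_essLE {a b : Λ} (h : H.essLE b a) : b ≤ a := by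
  have key : ∀ {X : C} {a b : Λ}, serreSub L (Set.Iic a) X → multiplicity X (L b) ≠ 0 →
      b ≤ a := fun {X a b} hX h => by
    by_contra hab
    exact h (hL.multiplicity_eq_zero_iff.2
      (serreSub_mono L (fun c hc => by rintro rfl; exact hab hc) hX))
  induction h with
  | refl => exact le_rfl
  | tail _ h ih =>
    exact ih.trans (h.elim (key (H.delta_mem _)) (key (H.nabla_mem _)))

variable (Ψ : Cᵒᵖ ≌ C) (hΨ : ∀ a : Λ, Nonempty (Ψ.functor.obj (op (L a)) ≅ L a))
  {Ω : Set Λ} (hΩ : H.IsEssIdeal Ω)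

include hΨ hΩ

lemma isEssIdeal_insert_iff {a : Λ} :
    H.IsEssIdeal (insert a Ω) ↔ serreSub L Ω (cokernel (H.ι a)) := by
  refine ⟨fun h => hL.serreSub_of_forall_notMem fun b hb => ?_,
    fun h => H.isEssIdeal_of_step fun x hx b hb => ?_⟩
  · by_cases hba : b = a
    · exact hba ▸ H.cokernel_ι_mem_compl hL a
    · refine serreSub_mono L (fun c hc => ?_) ((serreSub L _).prop_of_epi (cokernel.π (H.ι a))
        (H.nabla_mem_of_isEssIdeal hL h (Set.mem_insert a Ω)))
      rintro rfl
      exact hc.elim hba hb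
  · rcases hx with rfl | hx
    · by_contra hbx
      have hsub : ∀ {X : C}, serreSub L (insert x Ω) X → multiplicity X (L b) = 0 := fun hX =>
        hL.multiplicity_eq_zero_iff.2
          (serreSub_mono L (fun c hc => by rintro rfl; exact hbx hc) hX)
      have hs : serreSub L (insert x Ω) (L x) := serreSub_simple L (Set.mem_insert x Ω)
      rcases hb with hb | hb
      · exact hb (hsub ((serreSub L _).prop_X₂_of_shortExact (H.shortExact_π x)
          (serreSub_mono L (Set.subset_insert x Ω)
            (H.kernel_π_mem_of_cokernel_ι_mem Ψ hΨ h)) hs))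
      · exact hb (hsub ((serreSub L _).prop_X₂_of_shortExact (H.shortExact_ι x) hs
          (serreSub_mono L (Set.subset_insert x Ω) h)))
    · exact Or.inr (hΩ x hx b (.single hb))

universe w' v' u'

variable {D : Type u'} [Category.{v'} D] [Abelian D] (G : C ⥤ D) [G.Additive]
  [G.IsLocalization (serreSub L Ω).isoModSerre] [HasExt.{w'} D]
  (k : Type t) [Field k] [Linear k C] [∀ X Y : C, Module.Finite k (X ⟶ Y)]

include k in
lemma subsingleton_ext_map_simple_of_insert {a : Λ} (h : H.IsEssIdeal (insert a Ω)) (n : ℕ) :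
    Subsingleton (Ext.{w'} (G.obj (L a)) (G.obj (L a)) (n + 1)) :=
  have hQ := (H.isEssIdeal_insert_iff hL Ψ hΨ hΩ).1 h
  H.subsingleton_ext_map_simple hL hΩ G k (H.kernel_π_mem_of_cokernel_ι_mem Ψ hΨ hQ) hQ n

include k in
/-- An ideal for the essential order can be enlarged by `a` if and only if the simple object
labelled by `a` has no second self-extensions in the quotient. -/
theorem subsingleton_ext_two_map_simple_iff {a : Λ} (ha : a ∉ Ω) :
    Subsingleton (Ext.{w'} (G.obj (L a)) (G.obj (L a)) 2) ↔ H.IsEssIdeal (insert a Ω) := by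
  refine ⟨fun h => ?_, fun h => H.subsingleton_ext_map_simple_of_insert hL Ψ hΨ hΩ G k h 1⟩
  rw [H.isEssIdeal_insert_iff hL Ψ hΨ hΩ]
  by_contra hQ
  obtain ⟨g, hg⟩ := H.exists_hom_map_kernel_map_cokernel_ne_zero Ψ hΨ hL G hQ
  exact hg (H.hom_map_kernel_map_cokernel_eq_zero hL hΩ G ha h g)

omit hΨ hΩ

/-- Finite ideals for the essential order are those that can be exhausted one element at a time. -/
lemma isEssIdeal_iff_exists_enumeration (p : Set Λ → Λ → Prop)
    (hp : ∀ Ω a, H.IsEssIdeal Ω → a ∉ Ω → (p Ω a ↔ H.IsEssIdeal (insert a Ω)))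
    (Ω : Set Λ) (hf : Ω.Finite) :
    H.IsEssIdeal Ω ↔ ∃ (n : ℕ) (μ : Fin n → Λ), Function.Injective μ ∧ Set.range μ = Ω ∧
      ∀ i : Fin n, p (μ '' Set.Iio i) (μ i) := by
  constructor
  · intro hΩ
    induction hn : Ω.ncard using Nat.strong_induction_on generalizing Ω with
    | _ n ih =>
      rcases Ω.eq_empty_or_nonempty with rfl | hne
      · exact ⟨0, Fin.elim0, fun i => i.elim0, by simp, fun i => i.elim0⟩
      -- Maximality is for the given order. As the essential order implies it, removing a leaves an
      -- ideal for the essential order.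
      obtain ⟨a, ha⟩ := hf.exists_maximal hne
      have hΩ' : H.IsEssIdeal (Ω \ {a}) := fun x hx b hb => ⟨hΩ x hx.1 b hb, fun hba => by
        obtain rfl : b = a := hba
        have := H.le_of_essLE hL hb
        exact hx.2 (le_antisymm (ha.2 hx.1 this) this)⟩
      obtain ⟨m, μ, hμ, hr, hi⟩ := ih _ (hn ▸ Set.ncard_sdiff_singleton_lt_of_mem ha.1 hf)
        (Ω \ {a}) hf.sdiff hΩ' rfl
      have haμ : a ∉ Set.range μ := by rw [hr]; exact fun h => h.2 rfl
      refine ⟨m + 1, Fin.snoc μ a, (Fin.snoc_injective_iff).2 ⟨hμ, haμ⟩, ?_, fun i => ?_⟩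
      · rw [Fin.range_snoc, hr, Set.insert_sdiff_singleton, Set.insert_eq_of_mem ha.1]
      · induction i using Fin.lastCases with
        | last =>
          have : (Fin.snoc μ a : Fin (m + 1) → Λ) '' Set.Iio (Fin.last m) = Ω \ {a} := by
            rw [← hr]
            ext x
            constructor
            · rintro ⟨j, hj, rfl⟩
              obtain ⟨j, rfl⟩ := Fin.exists_castSucc_eq.2 (ne_of_lt hj)
              exact ⟨j, by simp⟩
            · rintro ⟨j, rfl⟩
              exact ⟨j.castSucc, Fin.castSucc_lt_last j, by simp⟩
          rw [this, Fin.snoc_last, hp _ _ hΩ' (fun h => h.2 rfl), Set.insert_sdiff_singleton,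
            Set.insert_eq_of_mem ha.1]
          exact hΩ
        | cast i =>
          have : (Fin.snoc μ a : Fin (m + 1) → Λ) '' Set.Iio i.castSucc = μ '' Set.Iio i := by
            ext x
            constructor
            · rintro ⟨j, hj, rfl⟩
              obtain ⟨j, rfl⟩ := Fin.exists_castSucc_eq.2
                (ne_of_lt (lt_of_lt_of_le hj (Fin.le_last _)))
              exact ⟨j, by simpa using hj, by simp⟩
            · rintro ⟨j, hj, rfl⟩
              exact ⟨j.castSucc, by simpa using hj, by simp⟩
          rw [this, Fin.snoc_castSucc]
          exact hi i
  · rintro ⟨n, μ, hμ, rfl, hi⟩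
    have key : ∀ m ≤ n, H.IsEssIdeal (μ '' {j | j.val < m}) := fun m => by
      induction m with
      | zero => intro _; simpa using H.isEssIdeal_empty
      | succ m ih =>
        intro hm
        have h₁ : μ '' {j | j.val < m + 1} = insert (μ ⟨m, hm⟩) (μ '' Set.Iio ⟨m, hm⟩) := by
          rw [← Set.image_insert_eq]
          congr 1
          ext j
          simp only [Set.mem_ofPred_eq, Set.mem_insert_iff, Set.mem_Iio, Fin.ext_iff, Fin.lt_def]
          omega
        have h₂ : H.IsEssIdeal (μ '' Set.Iio (⟨m, hm⟩ : Fin n)) := ih (by omega)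
        rw [h₁]
        refine (hp _ _ h₂ ?_).1 (hi ⟨m, hm⟩)
        rintro ⟨j, hj, hj'⟩
        exact (ne_of_lt hj) (hμ hj')
    have := key n le_rfl
    rwa [show {j : Fin n | j.val < n} = Set.univ from Set.eq_univ_of_forall fun j => j.2,
      Set.image_univ] at this

lemma isEssMin_iff_essLength_eq_zero {a : Λ} : H.IsEssMin a ↔ H.essLength a = 0 := by
  -- The supremum of an unbounded set of naturals is 0, so a bound is needed before length zero can
  -- be read as minimality.
  have hbdd : BddAbove {n | ∃ s : Fin (n + 1) → Λ, s 0 = a ∧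
      ∀ i : Fin n, H.essLT (s i.succ) (s i.castSucc)} := by
    refine ⟨(Set.Iic a).ncard, ?_⟩
    rintro n ⟨s, h0, hs⟩
    have hanti : StrictAnti s := Fin.strictAnti_iff_succ_lt.2 fun i =>
      lt_of_le_of_ne (H.le_of_essLE hL (hs i).1) (hs i).2
    have h₁ : Set.range s ⊆ Set.Iic a := by
      rintro _ ⟨i, rfl⟩
      exact h0 ▸ hanti.antitone (Fin.zero_le i)
    have h₂ := Set.ncard_le_ncard h₁ (H.lowerFinite a)
    rw [← Set.image_univ, Set.ncard_image_of_injective _ hanti.injective, Set.ncard_univ,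
      Nat.card_eq_fintype_card, Fintype.card_fin] at h₂
    omega
  constructor
  · intro h
    refine Nat.le_zero.1 (csSup_le' ?_)
    rintro n ⟨s, h0, hs⟩
    by_contra hn
    obtain ⟨m, rfl⟩ := Nat.exists_eq_succ_of_ne_zero (n := n) (by rintro rfl; exact hn le_rfl)
    have := hs 0
    rw [Fin.castSucc_zero, h0] at this
    exact this.2 (h _ this.1)
  · intro h b hb
    by_contra hne
    have : 1 ≤ H.essLength a := le_csSup hbdd ⟨![a, b], rfl, fun i => by
      rw [Subsingleton.elim i 0]
      exact ⟨hb, hne⟩⟩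
    omega

end LowerFiniteHighestWeight

section

variable {C : Type u} [Category.{v} C] [Abelian C]

lemma serreSub_empty_iff {Λ : Type s} (L : Λ → C) {X : C} : serreSub L ∅ X ↔ IsZero X :=
  ⟨fun h => h IsZero inferInstance fun _ h => h.elim, ObjectProperty.prop_of_isZero _⟩

lemma isLocalization_id_serreSub_empty {Λ : Type s} (L : Λ → C) :
    (𝟭 C).IsLocalization (serreSub L ∅).isoModSerre :=
  Functor.IsLocalization.for_id _ fun X Y f hf => by
    have : Mono f := Preadditive.mono_of_isZero_kernel f ((serreSub_empty_iff L).1 hf.1)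
    have : Epi f := Preadditive.epi_of_isZero_cokernel f ((serreSub_empty_iff L).1 hf.2)
    exact isIso_of_mono_of_epi f

lemma bijective_smul_mk₀_id {k : Type t} [Field k] [IsAlgClosed k] [Linear k C] (X : C) [Simple X]
    [Module.Finite k (X ⟶ X)] [HasExt.{max u v} C] :
    Function.Bijective (fun c : k => c • Ext.mk₀.{max u v} (𝟙 X)) := by
  have h : (fun c : k => c • Ext.mk₀.{max u v} (𝟙 X)) = Ext.mk₀ ∘ fun c : k => c • 𝟙 X := by
    funext c; exact (Ext.mk₀_smul c (𝟙 X)).symm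
  rw [h]
  refine (Ext.mk₀_bijective X X).comp ⟨fun c d hcd => ?_, endomorphism_simple_eq_smul_id k⟩
  exact smul_left_injective k (id_nonzero X) hcd

end

end LFHW

/-! ### Assembly of both parts -/

theorem mainTheorem9 {k : Type t} [Field k] [IsAlgClosed k]
    {C : Type u} [Category.{v} C] [Abelian C] [Linear k C]
    (hC : LFHW.IsFiniteLengthCategory k C)
    {Λ : Type s} [PartialOrder Λ] (L : Λ → C) (hL : LFHW.IsSimpleLabelling L)
    (H : LFHW.LowerFiniteHighestWeight L)
    (Ψ : Cᵒᵖ ≌ C) (hΨ : ∀ a : Λ, Nonempty (Ψ.functor.obj (Opposite.op (L a)) ≅ L a)) :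
    (∀ Ω : Set Λ, Ω.Finite →
      (H.IsEssIdeal Ω ↔
        ∃ (n : ℕ) (μ : Fin n → Λ), Function.Injective μ ∧ Set.range μ = Ω ∧
          ∀ i : Fin n,
            Subsingleton (LFHW.ExtGroup
              ((LFHW.toSerreQuotient L (μ '' Set.Iio i)).obj (L (μ i)))
              ((LFHW.toSerreQuotient L (μ '' Set.Iio i)).obj (L (μ i))) 2))) ∧
    (∀ a : Λ, List.TFAE [
      H.IsEssMin a,
      H.essLength a = 0,
      IsIso (H.π a) ∧ IsIso (H.ι a),
      Subsingleton (LFHW.ExtGroup (L a) (L a) 2),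
      LFHW.ExtAlgebraEqField k (L a)]) := by
  have := hC.finite_hom
  have := hC.isArtinian
  have := hC.isNoetherian
  refine ⟨fun Ω hf => ?_, fun a => ?_⟩
  · refine H.isEssIdeal_iff_exists_enumeration hL (fun Ω a => Subsingleton (LFHW.ExtGroup
      ((LFHW.toSerreQuotient L Ω).obj (L a)) ((LFHW.toSerreQuotient L Ω).obj (L a)) 2))
      (fun Ω a hΩ ha => ?_) Ω hf
    have := HasExt.standard (LFHW.SerreQuotient L Ω)
    exact H.subsingleton_ext_two_map_simple_iff hL Ψ hΨ hΩ (LFHW.toSerreQuotient L Ω) k ha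
  · have := HasExt.standard C
    -- For Ω = ∅ the Serre class consists of zero objects, so the identity functor is a quotient
    -- functor and the criterion speaks of Ext in C itself.
    have := LFHW.isLocalization_id_serreSub_empty L
    have := hL.simple a
    have := H.mono_ι a
    have := H.epi_π a
    have hins := H.isEssIdeal_singleton_iff (a := a)
    rw [← insert_empty_eq] at hins
    have hQ := (H.isEssIdeal_insert_iff hL Ψ hΨ H.isEssIdeal_empty (a := a)).symm.trans hins
    tfae_have 1 ↔ 2 := H.isEssMin_iff_essLength_eq_zero hL
    tfae_have 1 → 3 := fun h => by
      have h₁ := hQ.2 h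
      have h₂ := H.kernel_π_mem_of_cokernel_ι_mem Ψ hΨ h₁
      rw [LFHW.serreSub_empty_iff] at h₁ h₂
      have := Preadditive.mono_of_isZero_kernel _ h₂
      have := Preadditive.epi_of_isZero_cokernel _ h₁
      exact ⟨isIso_of_mono_of_epi _, isIso_of_mono_of_epi _⟩
    tfae_have 3 → 1 := fun ⟨_, _⟩ => hQ.1
      ((LFHW.serreSub_empty_iff L).2 (isZero_cokernel_of_epi (H.ι a)))
    tfae_have 4 → 1 := fun h => hins.1
      ((H.subsingleton_ext_two_map_simple_iff hL Ψ hΨ H.isEssIdeal_empty (𝟭 C) k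
        (Set.notMem_empty a)).1 h)
    tfae_have 1 → 5 := fun h => ⟨LFHW.bijective_smul_mk₀_id (L a), fun n hn => by
      obtain ⟨m, rfl⟩ := Nat.exists_eq_succ_of_ne_zero hn.ne'
      exact H.subsingleton_ext_map_simple_of_insert hL Ψ hΨ H.isEssIdeal_empty (𝟭 C) k
        (hins.2 h) m⟩
    tfae_have 5 → 4 := fun h => h.2 2 two_pos
    tfae_finish
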